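/- Let $A$ be a finite non-empty alphabet with an irreflexive symmetric relation $I\subseteq A\times A$, and let $\mathcal M=A^*/\langle ab=ba:(a,b)\in I\rangle$ be the associated trace monoid, with length $|u|$ and left divisibility $u\le v\iff\exists w,\ v=uw$. A clique is a finite set of pairwise independent letters, identified with the product of its letters in $\mathcal M$; let $\mathcal C$ be the set of cliques (including the empty one). For non-empty cliques write $c\to c'$ if every $a\in c'$ has some $b\in c$ with $(b,a)\notin I$. Every $u\in\mathcal M$ has a unique Cartier–Foata decomposition $u=c_1\cdots c_n$ into non-empty cliques with $c_1\to\cdots\to c_n$. Let $\partial\mathcal M$ be the set of infinite sequences $c_1\to c_2\to\cdots$ of non-empty cliques, and let $\overline{\mathcal M}=\mathcal M\cup\partial\mathcal M$ (disjoint union). For $\xi\in\overline{\mathcal M}$ let $\kappa_n(\xi)\in\mathcal M$ be the product of the first $n$ cliques of $\xi$ (of all of them if there are fewer), and put $\zeta\le\xi$ if $\kappa_n(\zeta)\le\kappa_n(\xi)$ for all $n\ge 0$. For $x\in\mathcal M$ let $\Uparrow x=\{v\in\overline{\mathcal M}: x\le v\}$ and $\uparrow x=\{\xi\in\partial\mathcal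 M: x\le\xi\}$. Equip $\overline{\mathcal M}$ with the topology generated by all subsets of $\mathcal M$ and all $\Uparrow x$, and with its Borel $\sigma$-algebra. Let $\mu_{\mathcal M}(X)=\sum_{c\in\mathcal C}(-1)^{|c|}X^{|c|}$ and $G(p)=\sum_{u\in\mathcal M}p^{|u|}$. Then $\mu_{\mathcal M}$ has a unique complex root of smallest modulus; this root $p_0$ (the principal root of $\mathcal M$) is real and positive, and for every $p\in(0,p_0]$ there is a unique probability measure $\nu_p$ on $\overline{\mathcal M}$ such that $\nu_p(\Uparrow x)=p^{|x|}$ for all $x\in\mathcal M$. If $p<p_0$, then $\nu_p(\mathcal M)=1$, $G(p)<\infty$, and $\nu_p(\{x\})=p^{|x|}/G(p)$ for all $x\in\mathcal M$. If $p=p_0$, then $\nu_{p_0}(\partial\mathcal M)=1$ and $\nu_{p_0}(\uparrow x)=p_0^{|x|}$ for all $x\in\mathcal M$. -/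

import Mathlib

/-- The congruence on the free monoid `A*` generated by the pairs `(ab, ba)` with `a`, `b`
independent. The independence relation, irreflexive and symmetric, is given as a simple graph. -/
def traceCon {A : Type*} (I : SimpleGraph A) : Con (FreeMonoid A) :=
  conGen fun u v => ∃ a b : A, I.Adj a b ∧
    u = FreeMonoid.of a * FreeMonoid.of b ∧ v = FreeMonoid.of b * FreeMonoid.of a

/-- The trace monoid `M(A, I)`. -/
def TraceMonoid {A : Type*} (I : SimpleGraph A) : Type _ := (traceCon I).Quotient

namespace TraceMonoid

noncomputable section

instance instMonoid {A : Type*} (I : SimpleGraph A) : Monoid (TraceMonoid I) :=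
  inferInstanceAs (Monoid (traceCon I).Quotient)

/-- The quotient morphism from words to traces. -/
def mk {A : Type*} (I : SimpleGraph A) : FreeMonoid A →* TraceMonoid I := (traceCon I).mk'

/-- The trace consisting of one letter. -/
def letter {A : Type*} (I : SimpleGraph A) (a : A) : TraceMonoid I := mk I (FreeMonoid.of a)

theorem letter_commute {A : Type*} {I : SimpleGraph A} {a b : A} (h : I.Adj a b) :
    Commute (letter I a) (letter I b) := by
  show mk I _ * mk I _ = mk I _ * mk I _
  rw [← map_mul, ← map_mul]
  exact (traceCon I).eq.2 (ConGen.Rel.of _ _ ⟨a, b, h, rfl, rfl⟩)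

theorem traceCon_le_ker {A : Type*} (I : SimpleGraph A) :
    traceCon I ≤ Con.ker (FreeMonoid.lift fun _ : A => Multiplicative.ofAdd (1 : ℕ)) := by
  refine Con.conGen_le.2 ?_
  rintro u v ⟨a, b, -, rfl, rfl⟩
  simp [Con.ker_rel]

/-- The length of traces as a morphism to the additive monoid of natural numbers. -/
def lengthHom {A : Type*} (I : SimpleGraph A) : TraceMonoid I →* Multiplicative ℕ :=
  (traceCon I).lift (FreeMonoid.lift fun _ : A => Multiplicative.ofAdd (1 : ℕ))
    (traceCon_le_ker I)

/-- The length of a trace: the length of any word that represents it. -/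
def length {A : Type*} {I : SimpleGraph A} (u : TraceMonoid I) : ℕ :=
  Multiplicative.toAdd (lengthHom I u)

theorem length_mk {A : Type*} (I : SimpleGraph A) (w : FreeMonoid A) :
    length (mk I w) = w.length := by
  induction w using FreeMonoid.inductionOn' with
  | one => rfl
  | of_mul a w ih =>
    have h : length (mk I (FreeMonoid.of a * w)) = 1 + length (mk I w) := by
      unfold length
      rw [map_mul, map_mul, toAdd_mul]
      rfl
    rw [h, ih, FreeMonoid.length_mul, FreeMonoid.length_of]

/-- Left divisibility of traces. -/
instance instLE {A : Type*} (I : SimpleGraph A) : LE (TraceMonoid I) :=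
  ⟨fun u v => ∃ w, v = u * w⟩

/-- The cliques of the graph `(A, I)`, including the empty one. -/
abbrev Clique {A : Type*} (I : SimpleGraph A) : Type _ := {c : Finset A // I.IsClique (c : Set A)}

theorem Clique.pairwise_commute {A : Type*} {I : SimpleGraph A} (c : Clique I) :
    (c.1 : Set A).Pairwise (Function.onFun Commute (letter I)) :=
  Set.Pairwise.imp (SimpleGraph.isClique_iff I |>.1 c.2) fun _ _ h => letter_commute h

/-- The product in the trace monoid of the elements of a clique, in any order. -/
def Clique.toTrace {A : Type*} {I : SimpleGraph A} (c : Clique I) : TraceMonoid I :=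
  c.1.noncommProd (letter I) c.pairwise_commute

/-- Cartier–Foata admissibility `c → c'`. -/
def Admissible {A : Type*} {I : SimpleGraph A} (c c' : Clique I) : Prop :=
  ∀ a ∈ c'.1, ∃ b ∈ c.1, ¬ I.Adj b a

/-- `l = (c₁, …, cₙ)` is a Cartier–Foata decomposition of `u`: the `cᵢ` are non-empty cliques,
`cᵢ → cᵢ₊₁`, and `u = c₁ ⋯ cₙ`. For `u = 1` this is the empty list. -/
def IsNormalForm {A : Type*} {I : SimpleGraph A} (l : List (Clique I)) (u : TraceMonoid I) :
    Prop :=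
  (∀ c ∈ l, c.1.Nonempty) ∧ l.IsChain Admissible ∧ (l.map Clique.toTrace).prod = u

/-- The Cartier–Foata decomposition of a trace (it exists and is unique, for every trace). -/
def normalForm {A : Type*} {I : SimpleGraph A} (u : TraceMonoid I) : List (Clique I) :=
  Classical.epsilon fun l => IsNormalForm l u

/-- The boundary at infinity: infinite paths `c₁ → c₂ → ⋯` of non-empty cliques
(indexed from `0`). -/
abbrev Boundary {A : Type*} (I : SimpleGraph A) : Type _ :=
  {ξ : ℕ → Clique I // (∀ n, (ξ n).1.Nonempty) ∧ ∀ n, Admissible (ξ n) (ξ (n + 1))}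

/-- The compactification: the disjoint union of the finite and of the infinite traces. -/
inductive Completion {A : Type*} (I : SimpleGraph A) : Type _
  | finite (u : TraceMonoid I) : Completion I
  | infinite (ξ : Boundary I) : Completion I

/-- The `n`-topping: the product of the first `n` cliques (all of them, if there are fewer). -/
def topping {A : Type*} {I : SimpleGraph A} (n : ℕ) : Completion I → TraceMonoid I
  | .finite u => (((normalForm u).take n).map Clique.toTrace).prod
  | .infinite ξ => ((List.range n).map fun i => (ξ.1 i).toTrace).prod

/-- `ζ ≤ ξ` when every topping of `ζ` left divides the same topping of `ξ`. -/
instance Completion.instLE {A : Type*} (I : SimpleGraph A) : LE (Completion I) :=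
  ⟨fun ζ ξ => ∀ n, topping n ζ ≤ topping n ξ⟩

/-- The set of finite traces, inside the compactification. -/
def finiteTraces {A : Type*} (I : SimpleGraph A) : Set (Completion I) :=
  Set.range Completion.finite

/-- The set of infinite traces, inside the compactification. -/
def infiniteTraces {A : Type*} (I : SimpleGraph A) : Set (Completion I) :=
  Set.range Completion.infinite

/-- The full elementary cylinder `⇑u`, of all finite or infinite traces above `u`. -/
def fullCylinder {A : Type*} {I : SimpleGraph A} (u : TraceMonoid I) : Set (Completion I) :=
  {v | Completion.finite u ≤ v}

/-- The elementary cylinder `↑u`, of all infinite traces above `u`. -/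
def cylinder {A : Type*} {I : SimpleGraph A} (u : TraceMonoid I) : Set (Completion I) :=
  {v | v ∈ infiniteTraces I ∧ Completion.finite u ≤ v}

/-- The topology generated by all sets of finite traces and all full cylinders. -/
instance Completion.instTopologicalSpace {A : Type*} (I : SimpleGraph A) :
    TopologicalSpace (Completion I) :=
  TopologicalSpace.generateFrom
    (Set.range (fun S : Set (TraceMonoid I) => Completion.finite '' S) ∪ Set.range fullCylinder)

/-- The Borel sigma-algebra of the compactification. -/
instance Completion.instMeasurableSpace {A : Type*} (I : SimpleGraph A) :
    MeasurableSpace (Completion I) := borel _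

instance Completion.instBorelSpace {A : Type*} (I : SimpleGraph A) :
    BorelSpace (Completion I) := ⟨rfl⟩

/-- The Möbius polynomial, the sum of `(-1)^|c| X^|c|` over all cliques `c`. -/
def mobiusPolynomial {A : Type*} [Finite A] (I : SimpleGraph A) : Polynomial ℤ :=
  ∑ c ∈ (Set.toFinite {c : Finset A | I.IsClique (c : Set A)}).toFinset,
    (-1) ^ c.card * Polynomial.X ^ c.card

/-- `z` is the principal root: the unique complex root of smallest modulus of the
Möbius polynomial. -/
def IsPrincipalRoot {A : Type*} [Finite A] (I : SimpleGraph A) (z : ℂ) : Prop :=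
  Polynomial.aeval z (mobiusPolynomial I) = 0 ∧
    ∀ w : ℂ, Polynomial.aeval w (mobiusPolynomial I) = 0 → w ≠ z → ‖z‖ < ‖w‖

/-- The growth series `G(p)`, the sum of `p^|u|` over all finite traces `u`. -/
def growthSeries {A : Type*} (I : SimpleGraph A) (p : ℝ) : ℝ :=
  ∑' u : TraceMonoid I, p ^ length u

end

end TraceMonoid

/-! Write `μ_S` for the Möbius polynomial of the subgraph induced on `S` (`cliqueSum`). Splitting
cliques according to a vertex `v` gives `μ_{S ∪ {v}}(z) = μ_S(z) - z μ_N(z)`, with `N` the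
neighbours of `v` in `S`. This recurrence carries the analytic half. Positivity on `[0, r)` passes
to subsets of the alphabet, and there the quotients `μ_T / μ_S`, `T ⊆ S`, satisfy `‖f(z) - 1‖ ≤
f(‖z‖) - 1`, as power series with non-negative coefficients and constant term 1 would. A complex
root of modulus at most the least positive root `p₀` is thereby forced to be real, so it is `p₀`.

The combinatorial half views a trace as a heap, each letter falling to the lowest level allowed by
the letters already there. The levels are the Cartier–Foata cliques, and `truncate n` keeps the
first `n` of them. A point of the completion is the same thing as a sequence of traces each of which
is the truncation of the next. If `u` has height at most `m`, then `u ≤ v` is decided by the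
`m`-topping of `v`.

If full cylinders have mass `p^|x|`, Möbius inversion dictates the law of the `n`-topping
(`toppingWeight`). For `n ≥ 1` the weight of `u` is `p^|u| μ_S(p)`, where `S` is the set of letters
independent of the clique at level `n - 1`; it is non-negative for `p ≤ p₀`. These laws are
projective, because the sums over the traces above a given one determine a weight, so they come from
a measure on the completion. The same inversion gives uniqueness, since topping fibres form a
π-system generating the Borel sets.

A finite trace receives mass `p^|x| μ_A(p)`. For `p < p₀` this factor is positive, so the growth
series converges, and the normalised weights `p^|x| / G(p)` define a measure with the same cylinder
values, hence the same measure. At `p₀` the factor vanishes, and the countable set of finite traces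
is null. -/

namespace TraceMonoid

/-! ### Möbius polynomials of induced subgraphs and the principal root. -/

open Classical in
/-- The Möbius polynomial of the subgraph induced on `S`, evaluated at `z`. -/
noncomputable def cliqueSum {A R : Type*} [CommRing R] (I : SimpleGraph A) (S : Finset A) (z : R) :
    R :=
  ∑ c ∈ S.powerset, if I.IsClique (c : Set A) then (-z) ^ c.card else 0

section

variable {A : Type*} (I : SimpleGraph A)

theorem cliqueSum_empty {R : Type*} [CommRing R] (z : R) : cliqueSum I ∅ z = 1 := by
  simp [cliqueSum]

-- A clique containing `v` is `v` together with a clique among its neighbours, which accounts for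
-- the second term.
open Classical in
theorem cliqueSum_insert {R : Type*} [CommRing R] {S : Finset A} {v : A} (hv : v ∉ S) (z : R) :
    cliqueSum I (insert v S) z =
      cliqueSum I S z - z * cliqueSum I (S.filter fun b => I.Adj v b) z := by
  unfold cliqueSum
  rw [Finset.sum_powerset_insert hv, sub_eq_add_neg, Finset.mul_sum, ← Finset.sum_neg_distrib]
  congr 1
  refine (Finset.sum_subset_zero_on_sdiff (Finset.powerset_mono.2 (Finset.filter_subset _ S))
    ?_ ?_).symm
  · intro t ht
    simp only [Finset.mem_sdiff, Finset.mem_powerset] at ht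
    refine if_neg fun hc => ht.2 fun b hb => Finset.mem_filter.2 ⟨ht.1 hb, ?_⟩
    exact hc (by simp) (by simp [hb]) (fun h => hv (h ▸ ht.1 hb))
  · intro t ht
    rw [Finset.mem_powerset] at ht
    have hvt : v ∉ t := fun h => hv (Finset.mem_filter.1 (ht h)).1
    have hiff : I.IsClique ((insert v t : Finset A) : Set A) ↔ I.IsClique (t : Set A) := by
      rw [Finset.coe_insert, SimpleGraph.isClique_insert]
      exact and_iff_left fun b hb _ => (Finset.mem_filter.1 (ht hb)).2
    rw [Finset.card_insert_of_notMem hvt]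
    by_cases h : I.IsClique (t : Set A)
    · rw [if_pos h, if_pos (hiff.2 h)]; ring
    · rw [if_neg h, if_neg (hiff.not.2 h)]; ring

theorem cliqueSum_zero {R : Type*} [CommRing R] (S : Finset A) : cliqueSum I S (0 : R) = 1 := by
  classical
  induction S using Finset.induction_on with
  | empty => exact cliqueSum_empty I 0
  | insert v S hv ih => rw [cliqueSum_insert I hv, ih]; ring

theorem continuous_cliqueSum {R : Type*} [CommRing R] [TopologicalSpace R] [IsTopologicalRing R]
    (S : Finset A) : Continuous fun z : R => cliqueSum I S z := by
  classical
  unfold cliqueSum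
  refine continuous_finsetSum _ fun c _ => ?_
  split_ifs <;> fun_prop

theorem ofReal_cliqueSum (S : Finset A) (t : ℝ) :
    ((cliqueSum I S t : ℝ) : ℂ) = cliqueSum I S (t : ℂ) := by
  classical
  unfold cliqueSum
  push_cast
  exact Finset.sum_congr rfl fun c _ => by split_ifs <;> simp

/-- If the Möbius polynomial is positive on `[0, r)`, then so are those of all subgraphs. -/
theorem cliqueSum_pos_of_subset {r : ℝ} {S T : Finset A} (hTS : T ⊆ S)
    (hS : ∀ t : ℝ, 0 ≤ t → t < r → 0 < cliqueSum I S t) :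
    ∀ t : ℝ, 0 ≤ t → t < r → 0 < cliqueSum I T t := by
  classical
  induction S using Finset.strongInduction generalizing T r with
  | H S ih =>
  rcases hTS.eq_or_ssubset with rfl | hlt
  · exact hS
  obtain ⟨v, hvS, hvT⟩ := Finset.exists_of_ssubset hlt
  have hins : insert v (S.erase v) = S := Finset.insert_erase hvS
  have hrec : ∀ t : ℝ, cliqueSum I S t = cliqueSum I (S.erase v) t -
      t * cliqueSum I ((S.erase v).filter fun b => I.Adj v b) t := fun t => by
    rw [← cliqueSum_insert I (Finset.notMem_erase v S), hins]
  refine ih (S.erase v) (Finset.erase_ssubset hvS)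
    (fun b hb => Finset.mem_erase.2 ⟨fun h => hvT (h ▸ hb), hTS hb⟩) ?_
  by_contra! hcon
  obtain ⟨t, ht0, htr, ht⟩ := hcon
  -- Let `s` be the first point where `μ_{S \ v}` fails to be positive. Up to `s` the neighbour
  -- polynomial is positive by induction, so at `s` it is still non-negative, and the recurrence
  -- gives `μ_S(s) ≤ 0`, a contradiction.
  set Z : Set ℝ := Set.Icc 0 t ∩ {x | cliqueSum I (S.erase v) x ≤ 0}
  have hZc : IsCompact Z :=
    isCompact_Icc.inter_right (isClosed_le (continuous_cliqueSum I _) continuous_const)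
  obtain ⟨s, ⟨⟨hs0, hst⟩, hs⟩, hmin⟩ := hZc.exists_isLeast ⟨t, ⟨ht0, le_rfl⟩, ht⟩
  have hpos : ∀ x : ℝ, 0 ≤ x → x < s → 0 < cliqueSum I (S.erase v) x := fun x hx0 hxs => by
    by_contra! hx
    exact absurd (hmin ⟨⟨hx0, hxs.le.trans hst⟩, hx⟩) (not_le.2 hxs)
  have hNpos := ih (S.erase v) (Finset.erase_ssubset hvS)
    (Finset.filter_subset (fun b => I.Adj v b) _) hpos
  have hs0' : 0 < s := by
    rcases hs0.eq_or_lt with rfl | h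
    · rw [Set.mem_ofPred_eq, cliqueSum_zero] at hs
      linarith
    · exact h
  have hN : 0 ≤ cliqueSum I ((S.erase v).filter fun b => I.Adj v b) s := by
    refine ge_of_tendsto (x := nhdsWithin s (Set.Iio s))
      ((continuous_cliqueSum I _).continuousAt.tendsto.mono_left nhdsWithin_le_nhds) ?_
    filter_upwards [Ioo_mem_nhdsLT hs0'] with x hx
    exact (hNpos x hx.1.le hx.2).le
  have h1 := hS s hs0 (hst.trans_lt htr)
  rw [hrec] at h1
  have h2 := mul_nonneg hs0 hN
  have h3 : cliqueSum I (S.erase v) s ≤ 0 := hs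
  linarith

/-- The relation `‖a - 1‖ ≤ x - 1` stands in for coefficientwise domination of power series with
constant term 1. Its stability under products, and under the geometric series below, is all the
induction on subgraphs needs. -/
theorem norm_mul_sub_one_le {a b : ℂ} {x y : ℝ} (ha : ‖a - 1‖ ≤ x - 1) (hb : ‖b - 1‖ ≤ y - 1) :
    ‖a * b - 1‖ ≤ x * y - 1 := by
  have h : a * b - 1 = (a - 1) * (b - 1) + (a - 1) + (b - 1) := by ring
  have h1 : ‖(a - 1) * (b - 1)‖ ≤ (x - 1) * (y - 1) := by
    rw [norm_mul]
    exact mul_le_mul ha hb (norm_nonneg _) ((norm_nonneg _).trans ha)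
  calc ‖a * b - 1‖ ≤ ‖(a - 1) * (b - 1)‖ + ‖a - 1‖ + ‖b - 1‖ := by
        rw [h]; exact norm_add₃_le
    _ ≤ (x - 1) * (y - 1) + (x - 1) + (y - 1) := by gcongr
    _ = x * y - 1 := by ring

theorem norm_inv_one_sub_sub_one_le {a : ℂ} {x : ℝ} (ha : ‖a‖ ≤ x) (hx : x < 1) :
    ‖(1 - a)⁻¹ - 1‖ ≤ (1 - x)⁻¹ - 1 := by
  have h1 : 1 - x ≤ ‖1 - a‖ := by
    have := norm_sub_norm_le (1 : ℂ) a
    rw [norm_one] at this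
    linarith
  have hpos : 0 < 1 - x := by linarith
  have hne : 1 - a ≠ 0 := norm_pos_iff.1 (hpos.trans_le h1)
  have e1 : (1 - a)⁻¹ - 1 = a / (1 - a) := by field_simp; ring
  have e2 : (1 - x)⁻¹ - 1 = x / (1 - x) := by field_simp; ring
  rw [e1, e2, norm_div]
  exact div_le_div₀ ((norm_nonneg a).trans ha) ha hpos h1

/-- In the region where all the Möbius polynomials of subgraphs are positive, the quotients
`μ_T / μ_S` are dominated by their values at real points. -/
theorem norm_cliqueSum_div_sub_one_le {z : ℂ} {S : Finset A}
    (hS : ∀ T ⊆ S, 0 < cliqueSum I T ‖z‖) :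
    cliqueSum I S z ≠ 0 ∧ ∀ T ⊆ S, ‖cliqueSum I T z / cliqueSum I S z - 1‖ ≤
      cliqueSum I T ‖z‖ / cliqueSum I S ‖z‖ - 1 := by
  classical
  induction S using Finset.strongInduction with
  | H S ih =>
  -- Deleting `v` gives `μ_S = μ_{S \ v} (1 - R)` with `R = z μ_N / μ_{S \ v}`. By induction `R` is
  -- dominated by its value `ρ` at `‖z‖`, and `μ_S(‖z‖) > 0` says exactly that `ρ < 1`.
  have key : ∀ v ∈ S, cliqueSum I S z ≠ 0 ∧ ∀ T ⊆ S.erase v,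
      ‖cliqueSum I T z / cliqueSum I S z - 1‖ ≤
        cliqueSum I T ‖z‖ / cliqueSum I S ‖z‖ - 1 := by
    intro v hv
    obtain ⟨hne, hle⟩ := ih _ (Finset.erase_ssubset hv) fun T hT =>
      hS T (hT.trans (Finset.erase_subset v S))
    have hpos := hS _ (Finset.erase_subset v S)
    have hpos' := hS _ subset_rfl
    have hrec : ∀ {R : Type} [CommRing R] (t : R), cliqueSum I S t =
        cliqueSum I (S.erase v) t -
          t * cliqueSum I ((S.erase v).filter fun b => I.Adj v b) t := fun t => by
      rw [← cliqueSum_insert I (Finset.notMem_erase v S), Finset.insert_erase hv]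
    have hNS : ((S.erase v).filter fun b => I.Adj v b) ⊆ S.erase v := Finset.filter_subset _ _
    generalize ((S.erase v).filter fun b => I.Adj v b) = N at hrec hNS
    generalize S.erase v = S' at *
    set R : ℂ := z * (cliqueSum I N z / cliqueSum I S' z) with hR
    set ρ : ℝ := ‖z‖ * (cliqueSum I N ‖z‖ / cliqueSum I S' ‖z‖) with hρ
    have hRle : ‖R‖ ≤ ρ := by
      rw [hR, norm_mul]
      refine mul_le_mul_of_nonneg_left ?_ (norm_nonneg z)
      have h1 := hle N hNS
      have h2 := norm_sub_norm_le (cliqueSum I N z / cliqueSum I S' z) 1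
      rw [norm_one] at h2
      linarith
    have e1 : cliqueSum I S z = cliqueSum I S' z * (1 - R) := by
      rw [hrec, hR]; field_simp
    have e2 : cliqueSum I S ‖z‖ = cliqueSum I S' ‖z‖ * (1 - ρ) := by
      rw [hrec, hρ]; field_simp
    have hρ1 : ρ < 1 := by
      rw [e2] at hpos'
      have := (mul_pos_iff_of_pos_left hpos).1 hpos'
      linarith
    have hR1 : 1 - R ≠ 0 := by
      intro h
      have : ‖R‖ = 1 := by rw [← sub_eq_zero.1 h, norm_one]
      linarith
    refine ⟨by rw [e1]; exact mul_ne_zero hne hR1, fun T hT => ?_⟩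
    rw [e1, e2, ← div_div, ← div_div, div_eq_mul_inv _ (1 - R), div_eq_mul_inv _ (1 - ρ)]
    exact norm_mul_sub_one_le (hle T hT) (norm_inv_one_sub_sub_one_le hRle hρ1)
  have hne : cliqueSum I S z ≠ 0 := by
    rcases S.eq_empty_or_nonempty with rfl | ⟨v, hv⟩
    · rw [cliqueSum_empty]; exact one_ne_zero
    · exact (key v hv).1
  refine ⟨hne, fun T hT => ?_⟩
  rcases hT.eq_or_ssubset with rfl | hlt
  · rw [div_self hne, div_self (hS _ subset_rfl).ne']
    simp
  · obtain ⟨v, hvS, hvT⟩ := Finset.exists_of_ssubset hlt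
    exact (key v hvS).2 T fun b hb => Finset.mem_erase.2 ⟨fun h => hvT (h ▸ hb), hT hb⟩

/-- A complex root of the Möbius polynomial with no real root of smaller modulus is real. -/
theorem eq_norm_of_cliqueSum_eq_zero {w : ℂ} {S : Finset A}
    (hS : ∀ t : ℝ, 0 ≤ t → t < ‖w‖ → 0 < cliqueSum I S t) (hw : cliqueSum I S w = 0) :
    w = ‖w‖ := by
  classical
  induction S using Finset.induction_on with
  | empty => exact absurd hw (by rw [cliqueSum_empty]; exact one_ne_zero)
  | insert v S hv ih =>
    -- Vertices are removed as long as `w` remains a root. At the critical vertex, `w μ_N(w) =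
    -- μ_S(w) ≠ 0`.
    by_cases hw' : cliqueSum I S w = 0
    · exact ih (cliqueSum_pos_of_subset I (Finset.subset_insert v S) hS) hw'
    have hins := fun (R : Type) [CommRing R] (t : R) => cliqueSum_insert I hv t
    have hNS : (S.filter fun b => I.Adj v b) ⊆ S := Finset.filter_subset _ _
    generalize (S.filter fun b => I.Adj v b) = N at hins hNS
    have hw0 : 0 < ‖w‖ := by
      rw [norm_pos_iff]
      rintro rfl
      rw [cliqueSum_zero] at hw'
      rw [cliqueSum_zero] at hw
      exact one_ne_zero hw
    -- The domination holds strictly inside the disc of radius `‖w‖`. Multiplying by `μ_S(sw)`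
    -- removes the denominators, so `s → 1` is harmless even if `μ_S(‖w‖) = 0`.
    have hineq : ∀ s : ℝ, 0 ≤ s → s < 1 →
        ‖((s : ℂ) * w) * cliqueSum I N (s * w) - (s * w) * cliqueSum I S (s * w)‖ ≤
          (1 - s * ‖w‖) * ‖cliqueSum I S (s * w)‖ := by
      intro s hs0 hs1
      set z : ℂ := s * w with hz
      have hzn : ‖z‖ = s * ‖w‖ := by
        rw [hz, norm_mul, Complex.norm_real, Real.norm_of_nonneg hs0]
      have hzlt : ‖z‖ < ‖w‖ := by
        rw [hzn]; exact mul_lt_of_lt_one_left hw0 hs1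
      have hpos : ∀ T ⊆ insert v S, 0 < cliqueSum I T ‖z‖ := fun T hT =>
        cliqueSum_pos_of_subset I hT hS _ (norm_nonneg z) hzlt
      obtain ⟨hne, hle⟩ := norm_cliqueSum_div_sub_one_le I (z := z) (S := S) fun T hT =>
        hpos T (hT.trans (Finset.subset_insert v S))
      have h1 := hpos _ subset_rfl
      have h2 := hpos S (Finset.subset_insert v S)
      rw [hins] at h1
      have h3 : ‖z‖ * (cliqueSum I N ‖z‖ / cliqueSum I S ‖z‖ - 1) ≤ 1 - ‖z‖ := by
        rw [mul_sub, mul_one, ← mul_div_assoc]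
        have : ‖z‖ * cliqueSum I N ‖z‖ / cliqueSum I S ‖z‖ ≤ 1 := by
          rw [div_le_one h2]; linarith
        linarith
      have h4 : z * cliqueSum I N z - z * cliqueSum I S z =
          z * (cliqueSum I N z / cliqueSum I S z - 1) * cliqueSum I S z := by
        field_simp
      rw [← hzn, h4, norm_mul, norm_mul]
      refine mul_le_mul_of_nonneg_right (le_trans ?_ h3) (norm_nonneg _)
      exact mul_le_mul_of_nonneg_left (hle N hNS) (norm_nonneg z)
    have hlim : ‖w * cliqueSum I N w - w * cliqueSum I S w‖ ≤ (1 - ‖w‖) * ‖cliqueSum I S w‖ := by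
      have hcN := continuous_cliqueSum (R := ℂ) I N
      have hcS := continuous_cliqueSum (R := ℂ) I S
      have hl : Continuous fun s : ℝ =>
          ‖((s : ℂ) * w) * cliqueSum I N (s * w) - (s * w) * cliqueSum I S (s * w)‖ := by
        fun_prop
      have hr : Continuous fun s : ℝ => (1 - s * ‖w‖) * ‖cliqueSum I S ((s : ℂ) * w)‖ := by
        fun_prop
      have h := le_of_tendsto_of_tendsto (b := nhdsWithin (1 : ℝ) (Set.Iio 1))
        (hl.continuousAt.tendsto.mono_left nhdsWithin_le_nhds)
        (hr.continuousAt.tendsto.mono_left nhdsWithin_le_nhds) ?_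
      · simpa using h
      · filter_upwards [Ioo_mem_nhdsLT (zero_lt_one (α := ℝ))] with s hs
        exact hineq s hs.1.le hs.2
    have hrec : w * cliqueSum I N w = cliqueSum I S w := by
      have := hins ℂ w
      rw [hw] at this
      exact (sub_eq_zero.1 this.symm).symm
    rw [hrec, ← one_sub_mul, norm_mul] at hlim
    -- Since `1 - Re w ≤ ‖1 - w‖`, this forces `Re w = ‖w‖`.
    have h1 : ‖1 - w‖ ≤ 1 - ‖w‖ := le_of_mul_le_mul_right hlim (norm_pos_iff.2 hw')
    have h2 : 1 - w.re ≤ ‖1 - w‖ := by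
      have := Complex.re_le_norm (1 - w)
      simpa using this
    have h3 : w.re = ‖w‖ := le_antisymm (Complex.re_le_norm w) (by linarith)
    have h4 := Complex.sq_norm w
    rw [Complex.normSq_apply, ← h3] at h4
    have h5 : w.im = 0 := by nlinarith
    apply Complex.ext
    · rw [h3, Complex.ofReal_re]
    · rw [h5, Complex.ofReal_im]

/-- The Möbius polynomial of a non-empty graph has a least positive real root, and this is its
unique complex root of smallest modulus. -/
theorem exists_least_root_cliqueSum {S : Finset A} (hne : S.Nonempty) :
    ∃ p₀ : ℝ, 0 < p₀ ∧ cliqueSum I S p₀ = 0 ∧ (∀ t : ℝ, 0 ≤ t → t < p₀ → 0 < cliqueSum I S t) ∧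
      ∀ w : ℂ, cliqueSum I S w = 0 → w ≠ p₀ → p₀ < ‖w‖ := by
  classical
  set Z : Set ℝ := Set.Icc 0 1 ∩ {x | cliqueSum I S x ≤ 0}
  have hZc : IsCompact Z :=
    isCompact_Icc.inter_right (isClosed_le (continuous_cliqueSum I _) continuous_const)
  -- Otherwise positivity would extend slightly beyond 1 and pass to a single vertex, whose
  -- polynomial `1 - t` vanishes at 1.
  have hZne : Z.Nonempty := by
    by_contra hZ
    obtain ⟨v, hv⟩ := hne
    have hpos : ∀ t : ℝ, 0 ≤ t → t < 1 → 0 < cliqueSum I S t := fun t h0 h1 => by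
      by_contra! h
      exact hZ ⟨t, ⟨h0, h1.le⟩, h⟩
    have hpos1 : 0 < cliqueSum I S (1 : ℝ) := by
      by_contra! h
      exact hZ ⟨1, ⟨zero_le_one, le_rfl⟩, h⟩
    obtain ⟨ε, hε, hball⟩ := Metric.isOpen_iff.1
      (isOpen_lt continuous_const (continuous_cliqueSum (R := ℝ) I S)) 1 hpos1
    have hsing := cliqueSum_pos_of_subset I (r := 1 + ε) (Finset.singleton_subset_iff.2 hv)
      (fun t h0 h1 => by
        rcases lt_or_ge t 1 with h | h
        · exact hpos t h0 h
        · refine hball ?_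
          rw [Metric.mem_ball, Real.dist_eq, abs_of_nonneg (by linarith)]
          linarith) 1 zero_le_one (by linarith)
    rw [← insert_empty_eq, cliqueSum_insert I (Finset.notMem_empty v), Finset.filter_empty,
      cliqueSum_empty] at hsing
    norm_num at hsing
  obtain ⟨p₀, ⟨⟨h0, h1⟩, hp⟩, hmin⟩ := hZc.exists_isLeast hZne
  have hpos : ∀ t : ℝ, 0 ≤ t → t < p₀ → 0 < cliqueSum I S t := fun t ht0 ht => by
    by_contra! h
    exact absurd (hmin ⟨⟨ht0, ht.le.trans h1⟩, h⟩) (not_le.2 ht)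
  have hp0 : 0 < p₀ := by
    rcases h0.eq_or_lt with rfl | h
    · rw [Set.mem_ofPred_eq, cliqueSum_zero] at hp
      linarith
    · exact h
  have hzero : cliqueSum I S p₀ = 0 := by
    refine le_antisymm hp (ge_of_tendsto (x := nhdsWithin p₀ (Set.Iio p₀))
      ((continuous_cliqueSum I _).continuousAt.tendsto.mono_left nhdsWithin_le_nhds) ?_)
    filter_upwards [Ioo_mem_nhdsLT hp0] with x hx
    exact (hpos x hx.1.le hx.2).le
  refine ⟨p₀, hp0, hzero, hpos, fun w hw hwp => ?_⟩
  by_contra! hle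
  have hreal := eq_norm_of_cliqueSum_eq_zero I (fun t ht0 ht => hpos t ht0 (ht.trans_le hle)) hw
  rw [hreal, ← ofReal_cliqueSum, Complex.ofReal_eq_zero] at hw
  rcases hle.eq_or_lt with h | h
  · exact hwp (by rw [hreal, h])
  · exact (hpos _ (norm_nonneg w) h).ne' hw

end

end TraceMonoid

/-! ### Random sequences from compatible marginals. -/

open MeasureTheory ProbabilityTheory in
/-- A sequence of probability distributions on a countable set, compatible with transition maps,
comes from a random sequence compatible with these maps. -/
theorem exists_measure_of_map_succ_eq {X : Type*} [MeasurableSpace X] [DiscreteMeasurableSpace X]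
    [Countable X] (P : ℕ → Measure X) [∀ n, IsProbabilityMeasure (P n)] (π : ℕ → X → X)
    (h : ∀ n, (P (n + 1)).map (π n) = P n) :
    ∃ μ : Measure (ℕ → X), IsProbabilityMeasure μ ∧ (∀ n, μ.map (fun ω => ω n) = P n) ∧
      ∀ᵐ ω ∂μ, ∀ n, π n (ω (n + 1)) = ω n := by
  classical
  -- The transition from `x` is `P (n + 1)` conditioned on the fibre over `x`. Over a null atom the
  -- Dirac mass is an arbitrary choice that keeps the kernel Markov.
  let T : ℕ → X → Measure X := fun n x =>
    if P n {x} = 0 then Measure.dirac x else (P (n + 1))[|π n ⁻¹' {x}]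
  have hfib : ∀ n x, P (n + 1) (π n ⁻¹' {x}) = P n {x} := fun n x => by
    rw [← h n, Measure.map_apply (Measurable.of_discrete) (MeasurableSet.of_discrete)]
  have hT : ∀ n x, IsProbabilityMeasure (T n x) := fun n x => by
    by_cases hx : P n {x} = 0
    · simp only [T, if_pos hx]; infer_instance
    · simp only [T, if_neg hx]
      exact cond_isProbabilityMeasure (by rwa [hfib])
  have hTP : ∀ n x s, P n {x} * T n x s = P (n + 1) (π n ⁻¹' {x} ∩ s) := fun n x s => by
    by_cases hx : P n {x} = 0
    · rw [hx, zero_mul]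
      exact (measure_mono_null Set.inter_subset_left (by rw [hfib, hx])).symm
    · simp only [T, if_neg hx]
      rw [mul_comm, ← hfib, cond_mul_eq_inter' MeasurableSet.of_discrete (measure_ne_top _ _)]
  let K : (n : ℕ) → Kernel (Π _ : Finset.Iic n, X) X := fun n =>
    { toFun := fun ω => T n (ω ⟨n, Finset.mem_Iic.2 le_rfl⟩)
      measurable' := (Measurable.of_discrete (f := T n)).comp (measurable_pi_apply _) }
  have hK : ∀ n, IsMarkovKernel (K n) := fun n => ⟨fun ω => hT n _⟩
  let μ : Measure (ℕ → X) := Kernel.trajMeasure (X := fun _ => X) (P 0) K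
  have hpair : ∀ n (s : Set (X × X)), MeasurableSet s → μ {ω | (ω n, ω (n + 1)) ∈ s} =
      ∫⁻ x, T n x (Prod.mk x ⁻¹' s) ∂μ.map (fun ω => ω n) := by
    intro n s hs
    have h1 := Kernel.map_frestrictLe_trajMeasure_compProd_eq_map_trajMeasure
      (X := fun _ => X) (μ₀ := P 0) (κ := K) (a := n)
    have hs' : MeasurableSet {q : (Π _ : Finset.Iic n, X) × X |
        (q.1 ⟨n, Finset.mem_Iic.2 le_rfl⟩, q.2) ∈ s} := hs.preimage (by fun_prop)
    have h2 := congrArg (fun m => m {q : (Π _ : Finset.Iic n, X) × X |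
        (q.1 ⟨n, Finset.mem_Iic.2 le_rfl⟩, q.2) ∈ s}) h1
    beta_reduce at h2
    rw [Measure.compProd_apply hs', Measure.map_apply (by fun_prop) hs',
      lintegral_map (Kernel.measurable_kernel_prodMk_left hs') (by fun_prop)] at h2
    rw [lintegral_map Measurable.of_discrete (by fun_prop)]
    exact h2.symm
  -- The law of each consecutive pair is carried along with the marginal: it yields the next
  -- marginal and also the almost sure compatibility.
  have hmarg : ∀ n, μ.map (fun ω => ω n) = P n ∧
      ∀ s : Set (X × X), μ {ω | (ω n, ω (n + 1)) ∈ s} = P (n + 1) {x | (π n x, x) ∈ s} := by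
    have hstep : ∀ n, μ.map (fun ω => ω n) = P n →
        ∀ s : Set (X × X), μ {ω | (ω n, ω (n + 1)) ∈ s} = P (n + 1) {x | (π n x, x) ∈ s} := by
      intro n hn s
      rw [hpair n s MeasurableSet.of_discrete, hn, lintegral_countable']
      have hU : {x | (π n x, x) ∈ s} = ⋃ x, π n ⁻¹' {x} ∩ Prod.mk x ⁻¹' s := by
        ext y; simp
      rw [hU, measure_iUnion _ fun _ => MeasurableSet.of_discrete]
      · exact tsum_congr fun x => by rw [mul_comm, hTP]
      · intro x y hxy
        refine Set.disjoint_left.2 fun z hz hz' => hxy ?_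
        rw [← hz.1, ← hz'.1]
    intro n
    induction n with
    | zero =>
      have h0 : μ.map (fun ω => ω 0) = P 0 := by
        have h1 : μ.map (Preorder.frestrictLe (π := fun _ => X) 0) =
            (P 0).map (MeasurableEquiv.piUnique fun _ : Finset.Iic 0 => X).symm := by
          change (Kernel.trajMeasure (X := fun _ => X) (P 0) K).map _ = _
          rw [Kernel.trajMeasure, Measure.map_comp _ _ (by fun_prop), Kernel.traj_map_frestrictLe,
            Kernel.partialTraj_self, Measure.id_comp]
        have h2 : (fun ω : ℕ → X => ω 0) =
            (fun q : (Π _ : Finset.Iic 0, X) => q ⟨0, Finset.mem_Iic.2 le_rfl⟩) ∘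
              Preorder.frestrictLe (π := fun _ => X) 0 := rfl
        rw [h2, ← Measure.map_map (by fun_prop) (by fun_prop), h1,
          Measure.map_map (by fun_prop) (by fun_prop)]
        exact Measure.map_id
      exact ⟨h0, hstep 0 h0⟩
    | succ n ih =>
      have h1 : μ.map (fun ω => ω (n + 1)) = P (n + 1) := by
        ext s hs
        rw [Measure.map_apply (by fun_prop) hs]
        exact ih.2 {q | q.2 ∈ s}
      exact ⟨h1, hstep _ h1⟩
  refine ⟨μ, inferInstance, fun n => (hmarg n).1, ae_all_iff.2 fun n => ?_⟩
  rw [ae_iff]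
  refine ((hmarg n).2 {q | ¬ π n q.2 = q.1}).trans ?_
  simp

namespace TraceMonoid

noncomputable section

open MulOpposite

/-! ### Cancellation and reversal in the trace monoid. -/

section Basic

variable {A : Type*} {I : SimpleGraph A}

theorem mk_surjective : Function.Surjective (mk I) := Con.mk'_surjective

theorem length_one : length (1 : TraceMonoid I) = 0 := by
  simp [length]

theorem length_mul (u v : TraceMonoid I) : length (u * v) = length u + length v := by
  simp [length, toAdd_mul]

theorem length_letter (a : A) : length (letter I a) = 1 := by
  rw [letter, length_mk, FreeMonoid.length_of]

/-- Induction on traces by multiplication by letters on the right. -/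
theorem induction_mul_letter {P : TraceMonoid I → Prop} (h1 : P 1)
    (h : ∀ u a, P u → P (u * letter I a)) (u : TraceMonoid I) : P u := by
  obtain ⟨w, rfl⟩ := mk_surjective u
  have key : ∀ l : List A, P (mk I (FreeMonoid.ofList l)) := fun l => by
    induction l using List.reverseRecOn with
    | nil => simpa using h1
    | append_singleton l a ih =>
      rw [FreeMonoid.ofList_append, map_mul]
      exact h _ a ih
  simpa using key (FreeMonoid.toList w)

theorem eq_one_of_length_eq_zero {u : TraceMonoid I} (h : length u = 0) : u = 1 := by
  induction u using induction_mul_letter with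
  | h1 => rfl
  | h u a _ => rw [length_mul, length_letter] at h; omega

/-- Morphisms from the trace monoid, from commuting images of independent letters. -/
def lift {M : Type*} [Monoid M] (f : A → M) (hf : ∀ a b, I.Adj a b → f a * f b = f b * f a) :
    TraceMonoid I →* M :=
  (traceCon I).lift (FreeMonoid.lift f) (Con.conGen_le.2 (by
    rintro u v ⟨a, b, h, rfl, rfl⟩
    simpa [Con.ker_rel] using hf a b h))

theorem lift_letter {M : Type*} [Monoid M] (f : A → M)
    (hf : ∀ a b, I.Adj a b → f a * f b = f b * f a) (a : A) : lift f hf (letter I a) = f a := by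
  change FreeMonoid.lift f (FreeMonoid.of a) = f a
  simp

theorem trace_le_refl (u : TraceMonoid I) : u ≤ u := ⟨1, (mul_one u).symm⟩

theorem trace_le_trans {u v w : TraceMonoid I} (h : u ≤ v) (h' : v ≤ w) : u ≤ w := by
  obtain ⟨x, rfl⟩ := h
  obtain ⟨y, rfl⟩ := h'
  exact ⟨x * y, mul_assoc u x y⟩

theorem length_le_of_le {u v : TraceMonoid I} (h : u ≤ v) : length u ≤ length v := by
  obtain ⟨w, rfl⟩ := h
  rw [length_mul]
  omega

theorem eq_of_le_of_length_le {u v : TraceMonoid I} (h : u ≤ v) (h' : length v ≤ length u) :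
    u = v := by
  obtain ⟨w, rfl⟩ := h
  rw [length_mul] at h'
  rw [eq_one_of_length_eq_zero (u := w) (by omega), mul_one]

-- Erasing the first occurrence of `a` respects the commutations, so it descends to traces and
-- undoes left multiplication by `a`. The membership clause decides in which factor of a product the
-- erasure happens.
open Classical in
theorem traceCon_erase (a : A) {u v : FreeMonoid A} (h : traceCon I u v) :
    (a ∈ u.toList ↔ a ∈ v.toList) ∧ mk I (FreeMonoid.ofList (u.toList.erase a)) =
      mk I (FreeMonoid.ofList (v.toList.erase a)) := by
  induction h with
  | of u v h =>
    obtain ⟨b, c, hbc, rfl, rfl⟩ := h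
    have hne : b ≠ c := hbc.ne
    have hcomm : mk I (FreeMonoid.of b) * mk I (FreeMonoid.of c) =
      mk I (FreeMonoid.of c) * mk I (FreeMonoid.of b) := letter_commute hbc
    simp only [FreeMonoid.toList_mul, FreeMonoid.toList_of, List.singleton_append]
    refine ⟨by simp [or_comm], ?_⟩
    by_cases hb : b = a
    · subst hb
      simp [hne.symm]
    · by_cases hc : c = a
      · subst hc
        simp [hne]
      · simp only [List.erase_cons, beq_iff_eq, hb, hc, if_false, List.erase_nil]
        simpa [FreeMonoid.ofList_cons] using hcomm
  | refl u => exact ⟨Iff.rfl, rfl⟩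
  | symm _ ih => exact ⟨ih.1.symm, ih.2.symm⟩
  | trans _ _ ih ih' => exact ⟨ih.1.trans ih'.1, ih.2.trans ih'.2⟩
  | @mul u v u' v' h h' ih ih' =>
    have e1 : mk I u = mk I v := (traceCon I).eq.2 h
    have e2 : mk I u' = mk I v' := (traceCon I).eq.2 h'
    simp only [FreeMonoid.toList_mul]
    refine ⟨by simp [ih.1, ih'.1], ?_⟩
    by_cases ha : a ∈ u.toList
    · rw [List.erase_append_left _ ha, List.erase_append_left _ (ih.1.1 ha),
        FreeMonoid.ofList_append, FreeMonoid.ofList_append, map_mul, map_mul, ih.2]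
      simp [e2]
    · rw [List.erase_append_right _ ha, List.erase_append_right _ (mt ih.1.2 ha),
        FreeMonoid.ofList_append, FreeMonoid.ofList_append, map_mul, map_mul, ih'.2]
      simp [e1]

theorem mul_left_cancel_letter {a : A} {u v : TraceMonoid I}
    (h : letter I a * u = letter I a * v) : u = v := by
  classical
  obtain ⟨u, rfl⟩ := mk_surjective u
  obtain ⟨v, rfl⟩ := mk_surjective v
  rw [letter, ← map_mul, ← map_mul] at h
  simpa using (traceCon_erase a ((traceCon I).eq.1 h)).2

theorem trace_mul_left_cancel {x u v : TraceMonoid I} (h : x * u = x * v) : u = v := by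
  induction x using induction_mul_letter generalizing u v with
  | h1 => simpa using h
  | h x a ih =>
    rw [mul_assoc, mul_assoc] at h
    exact mul_left_cancel_letter (ih h)

/-- The reversal of traces. -/
def rev : TraceMonoid I →* (TraceMonoid I)ᵐᵒᵖ :=
  lift (fun a => op (letter I a)) fun a b h => by
    rw [← op_mul, ← op_mul, (letter_commute h).eq]

theorem rev_letter (a : A) : (rev (letter I a)).unop = letter I a := by
  rw [rev, lift_letter, unop_op]

theorem rev_rev (u : TraceMonoid I) : (rev (rev u).unop).unop = u := by
  induction u using induction_mul_letter with
  | h1 => simp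
  | h u a ih => rw [map_mul, unop_mul, map_mul, unop_mul, ih, rev_letter, rev_letter]

theorem trace_mul_right_cancel {x u v : TraceMonoid I} (h : u * x = v * x) : u = v := by
  have h1 := congrArg (fun t => (rev t).unop) h
  simp only [map_mul, unop_mul] at h1
  rw [← rev_rev u, trace_mul_left_cancel h1, rev_rev]

end Basic

/-! ### Products of cliques. -/

section Clique

variable {A : Type*} {I : SimpleGraph A}

/-- The empty clique. -/
def emptyClique (I : SimpleGraph A) : Clique I := ⟨∅, by simp⟩

theorem toTrace_empty : (emptyClique I).toTrace = 1 := Finset.noncommProd_empty _ _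

open Classical in
theorem toTrace_insert {c : Clique I} {a : A} (ha : a ∉ c.1)
    (h : I.IsClique (insert a c.1 : Finset A)) :
    Clique.toTrace ⟨insert a c.1, h⟩ = c.toTrace * letter I a :=
  Finset.noncommProd_insert_of_notMem' _ _ _ _ ha

/-- Induction on cliques by insertion of letters. -/
theorem Clique.induction {P : Clique I → Prop} (h0 : P (emptyClique I))
    (h : ∀ (c d : Clique I) (a : A), a ∉ c.1 → (∀ b ∈ c.1, I.Adj b a) →
      (∀ b, b ∈ d.1 ↔ b = a ∨ b ∈ c.1) → d.toTrace = c.toTrace * letter I a → P c → P d)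
    (c : Clique I) : P c := by
  classical
  obtain ⟨c, hc⟩ := c
  induction c using Finset.induction_on with
  | empty => exact h0
  | insert a c ha ih =>
    have hc' : I.IsClique (c : Set A) := hc.subset (by simp)
    exact h ⟨c, hc'⟩ ⟨insert a c, hc⟩ a ha
      (fun b hb => hc (by simp [hb]) (by simp) fun hba => ha (hba ▸ hb))
      (fun b => Finset.mem_insert) (toTrace_insert (c := ⟨c, hc'⟩) ha hc) (ih hc')

theorem length_toTrace (c : Clique I) : length c.toTrace = c.1.card := by
  classical
  obtain ⟨c, hc⟩ := c
  induction c using Finset.induction_on with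
  | empty => exact (congrArg length toTrace_empty).trans length_one
  | insert a c ha ih =>
    have hc' : I.IsClique (c : Set A) := hc.subset (by simp)
    rw [toTrace_insert (c := ⟨c, hc'⟩) ha hc, length_mul, length_letter, ih hc',
      Finset.card_insert_of_notMem ha]

theorem toTrace_commute {c : Clique I} {a : A} (h : ∀ b ∈ c.1, I.Adj b a) :
    c.toTrace * letter I a = letter I a * c.toTrace :=
  (Finset.noncommProd_commute _ _ _ _ fun b hb => (letter_commute (h b hb)).symm).eq.symm

theorem rev_toTrace (c : Clique I) : (rev c.toTrace).unop = c.toTrace := by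
  induction c using Clique.induction with
  | h0 => rw [toTrace_empty]; simp
  | h c d a _ hadj _ hd ih =>
    rw [hd, map_mul, unop_mul, ih, rev_letter, toTrace_commute hadj]

theorem toTrace_le {c d : Clique I} (h : c.1 ⊆ d.1) : c.toTrace ≤ d.toTrace := by
  classical
  have hu : Disjoint c.1 (d.1 \ c.1) := Finset.disjoint_sdiff
  refine ⟨Clique.toTrace ⟨d.1 \ c.1, d.2.subset (by simp)⟩, ?_⟩
  have hcl : I.IsClique ((c.1 ∪ d.1 \ c.1 : Finset A) : Set A) := by
    rw [Finset.union_sdiff_of_subset h]; exact d.2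
  have hd : d = ⟨c.1 ∪ d.1 \ c.1, hcl⟩ := Subtype.ext (Finset.union_sdiff_of_subset h).symm
  conv_lhs => rw [hd]
  exact Finset.noncommProd_union_of_disjoint hu _ _

end Clique

end

end TraceMonoid

namespace TraceMonoid

noncomputable section

open MulOpposite

/-! ### Heaps, levels and truncation. -/

section Levels

variable {A : Type*} (I : SimpleGraph A)

/-- The level at which the letter `a` comes to rest when dropped on the heap `f`. -/
def dropLevel (a : A) (f : ℕ → Finset A) : ℕ :=
  sSup {k | ∃ i, k = i + 1 ∧ ∃ b ∈ f i, ¬ I.Adj b a}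

open Classical in
/-- The heap obtained by dropping the letter `a` on the heap `f`. -/
def drop (a : A) (f : ℕ → Finset A) : ℕ → Finset A :=
  Function.update f (dropLevel I a f) (insert a (f (dropLevel I a f)))

variable {I}

theorem mem_drop {a b : A} {f : ℕ → Finset A} {i : ℕ} :
    b ∈ drop I a f i ↔ b ∈ f i ∨ (b = a ∧ i = dropLevel I a f) := by
  unfold drop
  rcases eq_or_ne i (dropLevel I a f) with rfl | h
  · simp [or_comm]
  · simp [h]

/-- An independent letter never blocks `a`. Hence independent drops commute, and heaps carry a right
action of the trace monoid. -/
theorem dropLevel_drop {a b : A} (h : I.Adj a b) (f : ℕ → Finset A) :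
    dropLevel I a (drop I b f) = dropLevel I a f := by
  unfold dropLevel
  congr 1
  ext k
  refine exists_congr fun i => and_congr_right fun _ => ⟨?_, ?_⟩
  · rintro ⟨c, hc, hca⟩
    rcases mem_drop.1 hc with hc | ⟨rfl, -⟩
    · exact ⟨c, hc, hca⟩
    · exact absurd h.symm hca
  · rintro ⟨c, hc, hca⟩
    exact ⟨c, mem_drop.2 (Or.inl hc), hca⟩

theorem drop_comm {a b : A} (h : I.Adj a b) (f : ℕ → Finset A) :
    drop I a (drop I b f) = drop I b (drop I a f) := by
  ext i c
  rw [mem_drop, mem_drop, mem_drop, mem_drop, dropLevel_drop h, dropLevel_drop h.symm]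
  tauto

/-- The right action of traces on heaps. -/
def dropHom (I : SimpleGraph A) : TraceMonoid I →* (Function.End (ℕ → Finset A))ᵐᵒᵖ :=
  lift (fun a => op (drop I a : Function.End _)) fun a b h =>
    congrArg op (show (drop I b ∘ drop I a : _ → _) = drop I a ∘ drop I b from
      funext fun f => drop_comm h.symm f)

/-- The sets of letters at the successive levels of the heap of a trace. -/
def levelSet (u : TraceMonoid I) : ℕ → Finset A := (dropHom I u).unop fun _ => ∅

theorem levelSet_one (i : ℕ) : levelSet (1 : TraceMonoid I) i = ∅ := by
  unfold levelSet
  rw [map_one]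
  rfl

theorem levelSet_mul_letter (u : TraceMonoid I) (a : A) :
    levelSet (u * letter I a) = drop I a (levelSet u) := by
  unfold levelSet
  rw [map_mul, unop_mul, dropHom, lift_letter]
  rfl

theorem levelSet_subset_mul (u v : TraceMonoid I) (i : ℕ) : levelSet u i ⊆ levelSet (u * v) i := by
  induction v using induction_mul_letter with
  | h1 => rw [mul_one]
  | h v a ih =>
    rw [← mul_assoc, levelSet_mul_letter]
    exact fun b hb => mem_drop.2 (Or.inl (ih hb))

theorem levelSet_finite (u : TraceMonoid I) : ∃ n, ∀ i, n ≤ i → levelSet u i = ∅ := by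
  induction u using induction_mul_letter with
  | h1 => exact ⟨0, fun i _ => levelSet_one i⟩
  | h u a ih =>
    obtain ⟨n, hn⟩ := ih
    refine ⟨max n (dropLevel I a (levelSet u) + 1), fun i hi => ?_⟩
    ext b
    rw [levelSet_mul_letter, mem_drop, hn i ((le_max_left _ _).trans hi)]
    have := (le_max_right _ _).trans hi
    simp
    omega

/-- Without a bound the supremum in `dropLevel` would be the default value 0. The empty set also has
supremum 0, and this is intended: a letter that nothing blocks falls to level 0. -/
theorem bddAbove_dropLevel (u : TraceMonoid I) (a : A) :
    BddAbove {k | ∃ i, k = i + 1 ∧ ∃ b ∈ levelSet u i, ¬ I.Adj b a} := by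
  obtain ⟨n, hn⟩ := levelSet_finite u
  refine ⟨n, ?_⟩
  rintro k ⟨i, rfl, b, hb, -⟩
  by_contra! h
  rw [hn i (by omega)] at hb
  simp at hb

theorem adj_of_dropLevel_le {u : TraceMonoid I} {a b : A} {i : ℕ}
    (hi : dropLevel I a (levelSet u) ≤ i) (hb : b ∈ levelSet u i) : I.Adj b a := by
  by_contra h
  have : i + 1 ≤ dropLevel I a (levelSet u) :=
    le_csSup (bddAbove_dropLevel u a) ⟨i, rfl, b, hb, h⟩
  omega

theorem exists_not_adj_of_dropLevel_eq_succ {u : TraceMonoid I} {a : A} {i : ℕ}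
    (hi : dropLevel I a (levelSet u) = i + 1) : ∃ b ∈ levelSet u i, ¬ I.Adj b a := by
  have hne : {k | ∃ i, k = i + 1 ∧ ∃ b ∈ levelSet u i, ¬ I.Adj b a}.Nonempty := by
    by_contra h
    rw [Set.not_nonempty_iff_eq_empty] at h
    rw [dropLevel, h] at hi
    simp at hi
  obtain ⟨j, hj, h⟩ := Nat.sSup_mem hne (bddAbove_dropLevel u a)
  have : j = i := by
    have : i + 1 = j + 1 := hi.symm.trans hj
    omega
  rwa [this] at h

theorem isClique_levelSet (u : TraceMonoid I) (i : ℕ) : I.IsClique (levelSet u i : Set A) := by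
  induction u using induction_mul_letter with
  | h1 => rw [levelSet_one]; simp
  | h u a ih =>
    rw [levelSet_mul_letter]
    intro b hb c hc hbc
    rcases mem_drop.1 hb with hb' | ⟨rfl, hi⟩ <;> rcases mem_drop.1 hc with hc' | ⟨rfl, hi'⟩
    · exact ih hb' hc' hbc
    · exact adj_of_dropLevel_le hi'.ge hb'
    · exact (adj_of_dropLevel_le hi.ge hc').symm
    · exact absurd rfl hbc

theorem exists_not_adj_of_mem_levelSet_succ (u : TraceMonoid I) {i : ℕ} {a : A}
    (ha : a ∈ levelSet u (i + 1)) : ∃ b ∈ levelSet u i, ¬ I.Adj b a := by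
  induction u using induction_mul_letter generalizing a with
  | h1 => rw [levelSet_one] at ha; simp at ha
  | h u c ih =>
    rw [levelSet_mul_letter] at ha ⊢
    rcases mem_drop.1 ha with ha | ⟨rfl, h⟩
    · obtain ⟨b, hb, hba⟩ := ih ha
      exact ⟨b, mem_drop.2 (Or.inl hb), hba⟩
    · obtain ⟨b, hb, hba⟩ := exists_not_adj_of_dropLevel_eq_succ h.symm
      exact ⟨b, mem_drop.2 (Or.inl hb), hba⟩

/-- The levels of the heap of a trace, as cliques. -/
def levels (u : TraceMonoid I) (i : ℕ) : Clique I := ⟨levelSet u i, isClique_levelSet u i⟩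

theorem admissible_levels (u : TraceMonoid I) (i : ℕ) :
    Admissible (levels u i) (levels u (i + 1)) :=
  fun _ ha => exists_not_adj_of_mem_levelSet_succ u ha

/-- The product of the first `n` cliques of a sequence. -/
def prefixProd (s : ℕ → Clique I) (n : ℕ) : TraceMonoid I :=
  ((List.range n).map fun i => (s i).toTrace).prod

theorem prefixProd_zero (s : ℕ → Clique I) : prefixProd s 0 = 1 := rfl

theorem prefixProd_succ (s : ℕ → Clique I) (n : ℕ) :
    prefixProd s (n + 1) = prefixProd s n * (s n).toTrace := by
  simp [prefixProd, List.range_succ]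

theorem prefixProd_congr {s t : ℕ → Clique I} {n : ℕ} (h : ∀ i < n, s i = t i) :
    prefixProd s n = prefixProd t n := by
  induction n with
  | zero => rfl
  | succ n ih =>
    rw [prefixProd_succ, prefixProd_succ, ih fun i hi => h i (by omega), h n (by omega)]

theorem prefixProd_eq_of_le {s : ℕ → Clique I} {n m : ℕ} (hnm : n ≤ m)
    (h : ∀ i, n ≤ i → i < m → s i = emptyClique I) : prefixProd s m = prefixProd s n := by
  induction m, hnm using Nat.le_induction with
  | base => rfl
  | succ m hm ih =>
    rw [prefixProd_succ, ih fun i hi hi' => h i hi (by omega), h m hm (by omega), toTrace_empty,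
      mul_one]

theorem prefixProd_le_of_le (s : ℕ → Clique I) {n m : ℕ} (hnm : n ≤ m) :
    prefixProd s n ≤ prefixProd s m := by
  induction m, hnm using Nat.le_induction with
  | base => exact trace_le_refl _
  | succ m _ ih => exact trace_le_trans ih ⟨_, prefixProd_succ s m⟩

/-- The product of the first `n` levels of a trace. -/
def truncate (n : ℕ) (u : TraceMonoid I) : TraceMonoid I := prefixProd (levels u) n

/-- A letter landing at level `n` or higher is invisible to the truncation. One landing lower is
independent of every level from its own up to `n`, so it can be moved to the right end. -/
theorem truncate_mul_letter (n : ℕ) (u : TraceMonoid I) (a : A) :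
    truncate n (u * letter I a) = if n ≤ dropLevel I a (levelSet u) then truncate n u
      else truncate n u * letter I a := by
  induction n with
  | zero => simp [truncate, prefixProd_zero]
  | succ n ih =>
    have hlev : levelSet (u * letter I a) n = drop I a (levelSet u) n := by
      rw [levelSet_mul_letter]
    unfold truncate at ih ⊢
    rw [prefixProd_succ, prefixProd_succ, ih]
    rcases lt_trichotomy n (dropLevel I a (levelSet u)) with h | h | h
    · rw [if_pos h.le, if_pos (by omega)]
      congr 2
      refine Subtype.ext (hlev.trans ?_)
      rw [drop, Function.update_of_ne h.ne, levels]
    · rw [if_pos h.le, if_neg (by omega), mul_assoc]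
      congr 1
      have ha : a ∉ (levels u n).1 := fun hmem =>
        (adj_of_dropLevel_le h.ge hmem).ne rfl
      have hset : levelSet (u * letter I a) n = by classical exact insert a (levelSet u n) := by
        rw [hlev, drop, ← h, Function.update_self]
      rw [← toTrace_insert ha (by rw [levels]; exact hset ▸ isClique_levelSet _ n)]
      exact congrArg Clique.toTrace (Subtype.ext hset)
    · rw [if_neg (by omega), if_neg (by omega), mul_assoc, mul_assoc]
      congr 1
      have : levels (u * letter I a) n = levels u n := Subtype.ext (by
        refine hlev.trans ?_
        rw [drop, Function.update_of_ne h.ne', levels])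
      rw [this]
      exact (toTrace_commute fun b hb => adj_of_dropLevel_le h.le hb).symm

theorem truncate_mono (n : ℕ) {u v : TraceMonoid I} (h : u ≤ v) : truncate n u ≤ truncate n v := by
  obtain ⟨w, rfl⟩ := h
  induction w using induction_mul_letter with
  | h1 => rw [mul_one]; exact trace_le_refl _
  | h w a ih =>
    rw [← mul_assoc, truncate_mul_letter]
    split_ifs
    · exact ih
    · exact trace_le_trans ih ⟨_, rfl⟩

theorem truncate_eq_self {n : ℕ} {u : TraceMonoid I} (h : ∀ i, n ≤ i → levelSet u i = ∅) :
    truncate n u = u := by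
  induction u using induction_mul_letter with
  | h1 =>
    exact (prefixProd_eq_of_le (s := levels (1 : TraceMonoid I)) (Nat.zero_le n)
      fun i _ _ => Subtype.ext (levelSet_one (I := I) i)).trans (prefixProd_zero _)
  | h u a ih =>
    rw [levelSet_mul_letter] at h
    rw [truncate_mul_letter, if_neg, ih]
    · intro i hi
      have := h i hi
      exact Finset.subset_empty.1 fun b hb => this ▸ mem_drop.2 (Or.inl hb)
    · intro hle
      have hmem : a ∈ drop I a (levelSet u) (dropLevel I a (levelSet u)) :=
        mem_drop.2 (Or.inr ⟨rfl, rfl⟩)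
      rw [h _ hle] at hmem
      simp at hmem

/-- Nothing at level `n` or above blocks a letter of `c`, while level `n - 1`, if there is one,
does. So every letter of `c` stops exactly at level `n`. -/
theorem levelSet_mul_toTrace {u : TraceMonoid I} {n : ℕ} (hu : ∀ i, n ≤ i → levelSet u i = ∅)
    (c : Clique I) (hc : ∀ a ∈ c.1, ∀ m, n = m + 1 → ∃ b ∈ levelSet u m, ¬ I.Adj b a) :
    levelSet (u * c.toTrace) = Function.update (levelSet u) n c.1 := by
  induction c using Clique.induction with
  | h0 =>
    rw [toTrace_empty, mul_one]
    have : (emptyClique I).1 = levelSet u n := (hu n le_rfl).symm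
    rw [this, Function.update_eq_self]
  | h c d a ha hadj hdc hd ih =>
    have ih := ih fun b hb => hc b ((hdc b).2 (Or.inr hb))
    have hlev : dropLevel I a (levelSet (u * c.toTrace)) = n := by
      apply le_antisymm
      · by_contra! hlt
        obtain ⟨j, hj⟩ : ∃ j, dropLevel I a (levelSet (u * c.toTrace)) = j + 1 :=
          ⟨_, (Nat.succ_pred_eq_of_pos (by omega)).symm⟩
        obtain ⟨b, hb, hba⟩ := exists_not_adj_of_dropLevel_eq_succ hj
        rw [ih] at hb
        rcases eq_or_ne j n with rfl | hjn
        · rw [Function.update_self] at hb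
          exact hba (hadj b hb)
        · rw [Function.update_of_ne hjn, hu j (by omega)] at hb
          simp at hb
      · rcases n with _ | m
        · exact Nat.zero_le _
        · by_contra! hlt
          obtain ⟨b, hb, hba⟩ := hc a ((hdc a).2 (Or.inl rfl)) m rfl
          exact hba (adj_of_dropLevel_le (Nat.lt_succ_iff.1 hlt) (levelSet_subset_mul _ _ _ hb))
    rw [hd, ← mul_assoc, levelSet_mul_letter]
    ext i b
    rw [mem_drop, hlev, ih]
    rcases eq_or_ne i n with rfl | hin
    · rw [Function.update_self, Function.update_self, hdc]
      tauto
    · rw [Function.update_of_ne hin, Function.update_of_ne hin]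
      simp [hin]

theorem levelSet_prefixProd {s : ℕ → Clique I} (hs : ∀ n, Admissible (s n) (s (n + 1))) (n i : ℕ) :
    levelSet (prefixProd s n) i = if i < n then (s i).1 else ∅ := by
  induction n generalizing i with
  | zero => rw [prefixProd_zero, levelSet_one]; simp
  | succ n ih =>
    rw [prefixProd_succ, levelSet_mul_toTrace (n := n)]
    · rcases lt_trichotomy i n with h | rfl | h
      · rw [Function.update_of_ne h.ne, ih, if_pos h, if_pos (by omega)]
      · rw [Function.update_self, if_pos (by omega)]
      · rw [Function.update_of_ne h.ne', ih, if_neg (by omega), if_neg (by omega)]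
    · intro j hj
      rw [ih, if_neg (by omega)]
    · rintro a ha m rfl
      rw [ih, if_pos (by omega)]
      exact hs m a ha

theorem levels_prefixProd {s : ℕ → Clique I} (hs : ∀ n, Admissible (s n) (s (n + 1))) {n i : ℕ}
    (hi : i < n) : levels (prefixProd s n) i = s i :=
  Subtype.ext ((levelSet_prefixProd hs n i).trans (if_pos hi))

theorem levels_injective : Function.Injective (levels : TraceMonoid I → ℕ → Clique I) := by
  intro u v h
  obtain ⟨n, hn⟩ := levelSet_finite u
  have hn' : ∀ i, n ≤ i → levelSet v i = ∅ := fun i hi => by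
    rw [← hn i hi]
    exact congrArg Subtype.val (congrFun h i).symm
  rw [← truncate_eq_self hn, ← truncate_eq_self hn', truncate, truncate, h]

theorem truncate_prefixProd {s : ℕ → Clique I} (hs : ∀ n, Admissible (s n) (s (n + 1))) (n m : ℕ) :
    truncate n (prefixProd s m) = prefixProd s (min n m) := by
  rcases le_total n m with h | h
  · rw [min_eq_left h]
    exact prefixProd_congr fun i hi => levels_prefixProd hs (by omega)
  · rw [min_eq_right h]
    refine truncate_eq_self fun i hi => ?_
    rw [levelSet_prefixProd hs, if_neg (by omega)]

theorem truncate_le (n : ℕ) (u : TraceMonoid I) : truncate n u ≤ u := by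
  obtain ⟨m, hm⟩ := levelSet_finite u
  rcases le_total n m with h | h
  · conv_rhs => rw [← truncate_eq_self hm]
    exact prefixProd_le_of_le _ h
  · rw [truncate_eq_self fun i hi => hm i (h.trans hi)]
    exact trace_le_refl u

theorem truncate_truncate (n m : ℕ) (u : TraceMonoid I) :
    truncate n (truncate m u) = truncate (min n m) u :=
  truncate_prefixProd (admissible_levels u) n m

/-- By admissibility an empty level has only empty levels above it. The equation `truncate n u = u`
serves throughout to say that `u` has height at most `n`. -/
theorem truncate_eq_self_iff {n : ℕ} {u : TraceMonoid I} :
    truncate n u = u ↔ levelSet u n = ∅ := by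
  constructor
  · intro h
    rw [← h, truncate, levelSet_prefixProd (admissible_levels u), if_neg (lt_irrefl n)]
  · intro h
    refine truncate_eq_self fun i hi => ?_
    induction i, hi using Nat.le_induction with
    | base => exact h
    | succ i _ ih =>
      refine Finset.eq_empty_of_forall_notMem fun a ha => ?_
      obtain ⟨b, hb, -⟩ := exists_not_adj_of_mem_levelSet_succ u ha
      rw [ih] at hb
      simp at hb

theorem toTrace_le_iff {c : Clique I} {u : TraceMonoid I} :
    c.toTrace ≤ u ↔ c.1 ⊆ levelSet u 0 := by
  constructor
  · rintro ⟨w, rfl⟩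
    have h := levelSet_mul_toTrace (u := (1 : TraceMonoid I)) (n := 0)
      (fun i _ => levelSet_one i) c (fun a _ m h => by omega)
    rw [one_mul] at h
    have h0 := levelSet_subset_mul c.toTrace w 0
    rwa [h, Function.update_self] at h0
  · intro h
    refine trace_le_trans (toTrace_le (d := levels u 0) h) ?_
    have := truncate_le 1 u
    rwa [truncate, prefixProd_succ, prefixProd_zero, one_mul] at this

end Levels

/-! ### Normal forms, toppings and the order on the completion. -/

section Completion

variable {A : Type*} {I : SimpleGraph A}

theorem exists_isNormalForm (u : TraceMonoid I) : ∃ l : List (Clique I), IsNormalForm l u := by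
  classical
  have hex : ∃ n, levelSet u n = ∅ := by
    obtain ⟨n, hn⟩ := levelSet_finite u
    exact ⟨n, hn n le_rfl⟩
  refine ⟨(List.range (Nat.find hex)).map (levels u), ?_, ?_, ?_⟩
  · intro c hc
    obtain ⟨i, hi, rfl⟩ := List.mem_map.1 hc
    exact Finset.nonempty_iff_ne_empty.2 (Nat.find_min hex (List.mem_range.1 hi))
  · rw [List.isChain_iff_getElem]
    intro i hi
    simpa using admissible_levels u i
  · rw [List.map_map]
    exact truncate_eq_self_iff.2 (Nat.find_spec hex)

theorem prod_take_eq_prefixProd (l : List (Clique I)) (n : ℕ) :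
    ((l.take n).map Clique.toTrace).prod =
      prefixProd (fun i => l.getD i (emptyClique I)) n := by
  induction n with
  | zero => rfl
  | succ n ih =>
    rw [prefixProd_succ, ← ih, List.take_add_one, List.map_append, List.prod_append]
    congr 1
    rcases lt_or_ge n l.length with h | h
    · simp [h]
    · simp [h, toTrace_empty]

/-- An admissible sequence is recovered as the levels of its own product. This is uniqueness of the
Cartier–Foata decomposition, and it makes the choice in `normalForm` explicit. -/
theorem IsNormalForm.getD_eq_levels {l : List (Clique I)} {u : TraceMonoid I}
    (h : IsNormalForm l u) (i : ℕ) : l.getD i (emptyClique I) = levels u i := by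
  obtain ⟨-, hchain, hprod⟩ := h
  have hadm : ∀ n, Admissible (l.getD n (emptyClique I)) (l.getD (n + 1) (emptyClique I)) := by
    intro n
    rcases lt_or_ge (n + 1) l.length with hn | hn
    · rw [List.getD_eq_getElem _ _ hn, List.getD_eq_getElem _ _ (by omega)]
      exact List.isChain_iff_getElem.1 hchain n hn
    · rw [List.getD_eq_default _ _ hn]
      intro a ha
      exact absurd ha (Finset.notMem_empty a)
  have hu : u = prefixProd (fun i => l.getD i (emptyClique I)) (max l.length (i + 1)) := by
    rw [← prod_take_eq_prefixProd, List.take_of_length_le (le_max_left _ _), hprod]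
  rw [hu, levels_prefixProd hadm (by omega)]

theorem topping_finite (n : ℕ) (u : TraceMonoid I) : topping n (.finite u) = truncate n u := by
  have h : IsNormalForm (normalForm u) u := Classical.epsilon_spec (exists_isNormalForm u)
  change (((normalForm u).take n).map Clique.toTrace).prod = _
  rw [prod_take_eq_prefixProd]
  exact prefixProd_congr fun i _ => h.getD_eq_levels i

/-- The sequence of cliques of a finite or infinite trace, padded with empty cliques. -/
def cliqueSeq : Completion I → ℕ → Clique I
  | .finite u => levels u
  | .infinite ξ => ξ.1

theorem topping_eq_prefixProd (n : ℕ) (v : Completion I) :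
    topping n v = prefixProd (cliqueSeq v) n := by
  cases v with
  | finite u => exact topping_finite n u
  | infinite ξ => rfl

theorem admissible_cliqueSeq (v : Completion I) (n : ℕ) :
    Admissible (cliqueSeq v n) (cliqueSeq v (n + 1)) := by
  cases v with
  | finite u => exact admissible_levels u n
  | infinite ξ => exact ξ.2.2 n

theorem cliqueSeq_injective : Function.Injective (cliqueSeq : Completion I → ℕ → Clique I) := by
  have hne : ∀ (u : TraceMonoid I) (ξ : Boundary I), levels u ≠ ξ.1 := fun u ξ h => by
    obtain ⟨n, hn⟩ := levelSet_finite u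
    have h1 := ξ.2.1 n
    rw [← h] at h1
    exact h1.ne_empty (hn n le_rfl)
  intro v w h
  cases v <;> cases w
  · exact congrArg _ (levels_injective h)
  · exact absurd h (hne _ _)
  · exact absurd h.symm (hne _ _)
  · exact congrArg _ (Subtype.ext h)

theorem exists_cliqueSeq_eq {s : ℕ → Clique I} (hs : ∀ n, Admissible (s n) (s (n + 1))) :
    ∃ v : Completion I, cliqueSeq v = s := by
  by_cases h : ∀ n, (s n).1.Nonempty
  · exact ⟨.infinite ⟨s, h, hs⟩, rfl⟩
  · push Not at h
    obtain ⟨n, hn⟩ := h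
    have hempty : ∀ i, n ≤ i → (s i).1 = ∅ := fun i hi => by
      induction i, hi using Nat.le_induction with
      | base => exact hn
      | succ i _ ih =>
        refine Finset.eq_empty_of_forall_notMem fun a ha => ?_
        obtain ⟨b, hb, -⟩ := hs i a ha
        rw [ih] at hb
        exact Finset.notMem_empty b hb
    refine ⟨.finite (prefixProd s n), funext fun i => Subtype.ext ?_⟩
    change levelSet _ i = _
    rw [levelSet_prefixProd hs]
    split_ifs with hi
    · rfl
    · exact (hempty i (not_lt.1 hi)).symm

theorem truncate_topping (n m : ℕ) (v : Completion I) :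
    truncate n (topping m v) = topping (min n m) v := by
  rw [topping_eq_prefixProd, topping_eq_prefixProd, truncate_prefixProd (admissible_cliqueSeq v)]

theorem levels_topping {i n : ℕ} (hi : i < n) (v : Completion I) :
    levels (topping n v) i = cliqueSeq v i := by
  rw [topping_eq_prefixProd, levels_prefixProd (admissible_cliqueSeq v) hi]

/-- Truncation is monotone, so one comparison at a level bounding the height of `u` implies all the
others. -/
theorem finite_le_iff {u : TraceMonoid I} {m : ℕ} (hu : truncate m u = u) (v : Completion I) :
    Completion.finite u ≤ v ↔ u ≤ topping m v := by
  constructor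
  · intro h
    have := h m
    rwa [topping_finite, hu] at this
  · intro h n
    rw [topping_finite]
    refine trace_le_trans (truncate_mono n h) ?_
    rw [truncate_topping, topping_eq_prefixProd, topping_eq_prefixProd]
    exact prefixProd_le_of_le _ (min_le_left n m)

theorem exists_truncate_eq_self (u : TraceMonoid I) : ∃ m, truncate m u = u := by
  obtain ⟨m, hm⟩ := levelSet_finite u
  exact ⟨m, truncate_eq_self hm⟩

theorem truncate_eq_self_of_le {m n : ℕ} (h : m ≤ n) {u : TraceMonoid I} (hu : truncate m u = u) :
    truncate n u = u := by
  rw [← hu, truncate_truncate, min_eq_right h]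

theorem finite_le_finite_iff {u v : TraceMonoid I} :
    Completion.finite u ≤ Completion.finite v ↔ u ≤ v := by
  obtain ⟨m, hm⟩ := exists_truncate_eq_self u
  obtain ⟨n, hn⟩ := exists_truncate_eq_self v
  rw [finite_le_iff (truncate_eq_self_of_le (le_max_left m n) hm), topping_finite,
    truncate_eq_self_of_le (le_max_right m n) hn]

theorem fullCylinder_eq_preimage {u : TraceMonoid I} {m : ℕ} (hu : truncate m u = u) :
    fullCylinder u = topping m ⁻¹' {x : TraceMonoid I | u ≤ x} :=
  Set.ext fun v => finite_le_iff hu v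

/-- One level beyond the height is needed: the `m`-topping cannot tell `u` from its extensions,
whereas the empty clique at level `m` shows that the trace has stopped. -/
theorem singleton_finite_eq_preimage {u : TraceMonoid I} {m : ℕ} (hu : truncate m u = u) :
    {Completion.finite u} = topping (m + 1) ⁻¹' {u} := by
  ext v
  rw [Set.mem_singleton_iff, Set.mem_preimage, Set.mem_singleton_iff]
  constructor
  · rintro rfl
    rw [topping_finite, truncate_eq_self_of_le (Nat.le_succ m) hu]
  · intro h
    have hm : (cliqueSeq v m).1 = ∅ := by
      rw [← levels_topping (Nat.lt_succ_self m), h]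
      exact truncate_eq_self_iff.1 hu
    cases v with
    | finite w =>
      have hw : truncate m w = w := truncate_eq_self_iff.2 hm
      rw [topping_finite, truncate_eq_self_of_le (Nat.le_succ m) hw] at h
      rw [h]
    | infinite ξ => exact absurd hm (ξ.2.1 m).ne_empty

/-- A sequence of traces in which each term is a truncation of the next one converges to a point
of the completion. -/
theorem exists_topping_eq {ω : ℕ → TraceMonoid I} (hω : ∀ n, truncate n (ω (n + 1)) = ω n) :
    ∃ v : Completion I, ∀ n, topping n v = ω n := by
  have hadm : ∀ n, Admissible (levels (ω (n + 1)) n) (levels (ω (n + 2)) (n + 1)) := fun n => by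
    have : levels (ω (n + 1)) n = levels (ω (n + 2)) n := by
      rw [← hω (n + 1)]
      exact levels_prefixProd (admissible_levels _) (Nat.lt_succ_self n)
    rw [this]
    exact admissible_levels _ n
  obtain ⟨v, hv⟩ := exists_cliqueSeq_eq (s := fun n => levels (ω (n + 1)) n) hadm
  have hself : ∀ n, truncate n (ω n) = ω n := fun n => by
    rw [← hω n, truncate_truncate, min_self]
  refine ⟨v, fun n => ?_⟩
  rw [topping_eq_prefixProd, hv]
  induction n with
  | zero => exact hself 0
  | succ n ih =>
    rw [prefixProd_succ, ih]
    conv_lhs => rw [← hω n]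
    exact (prefixProd_succ _ n).symm.trans (hself (n + 1))

end Completion

/-! ### The Borel σ-algebra and topping fibres. -/

section Measurable

variable {A : Type*} (I : SimpleGraph A)

instance [Finite A] : Countable (TraceMonoid I) := by
  have : Countable (FreeMonoid A) := inferInstanceAs (Countable (List A))
  exact (mk_surjective (I := I)).countable

/-- The sets of points of the completion with a given topping. -/
def toppingFibers : Set (Set (Completion I)) :=
  {s | ∃ (n : ℕ) (u : TraceMonoid I), s = topping n ⁻¹' {u}}

variable {I}

theorem isOpen_image_finite (S : Set (TraceMonoid I)) : IsOpen (Completion.finite '' S) :=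
  .basic _ (Or.inl ⟨S, rfl⟩)

theorem isOpen_fullCylinder (u : TraceMonoid I) : IsOpen (fullCylinder u) :=
  .basic _ (Or.inr ⟨u, rfl⟩)

theorem measurableSet_singleton_finite (u : TraceMonoid I) :
    MeasurableSet {Completion.finite u} := by
  rw [← Set.image_singleton]
  exact (isOpen_image_finite {u}).measurableSet

/-- The `n`-topping of `v` is the greatest trace of height at most `n` below `v`. The fibre is thus
a full cylinder minus countably many smaller ones. -/
theorem measurableSet_toppingFiber [Finite A] (n : ℕ) (u : TraceMonoid I) :
    MeasurableSet (topping n ⁻¹' {u} : Set (Completion I)) := by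
  by_cases hu : truncate n u = u
  · have : (topping n ⁻¹' {u} : Set (Completion I)) =
        fullCylinder u \ ⋃ x ∈ {x | truncate n x = x ∧ u ≤ x ∧ x ≠ u}, fullCylinder x := by
      ext v
      simp only [Set.mem_preimage, Set.mem_singleton_iff, Set.mem_sdiff, Set.mem_iUnion,
        Set.mem_ofPred_eq, not_exists, and_imp, exists_prop, not_and]
      rw [fullCylinder_eq_preimage hu]
      constructor
      · intro h
        refine ⟨?_, fun x hx hux hne => ?_⟩
        · rw [Set.mem_preimage, h]
          exact trace_le_refl u
        · rw [fullCylinder_eq_preimage hx, Set.mem_preimage, h]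
          intro hxu
          exact hne (eq_of_le_of_length_le hxu (length_le_of_le hux))
      · rintro ⟨h1, h2⟩
        by_contra hne
        have hself : truncate n (topping n v) = topping n v := by
          rw [truncate_topping, min_self]
        refine h2 (topping n v) hself h1 hne ?_
        rw [fullCylinder_eq_preimage hself]
        exact trace_le_refl _
    rw [this]
    exact (isOpen_fullCylinder u).measurableSet.diff
      (.biUnion (Set.to_countable _) fun x _ => (isOpen_fullCylinder x).measurableSet)
  · have : (topping n ⁻¹' {u} : Set (Completion I)) = ∅ := by
      ext v
      refine iff_of_false (fun h => hu ?_) (Set.notMem_empty v)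
      rw [← Set.mem_singleton_iff.1 (Set.mem_preimage.1 h), truncate_topping, min_self]
    rw [this]
    exact .empty

/-- Singletons of finite traces and full cylinders form a countable subbasis, so they generate the
Borel sets. Each of them is a preimage under some topping. -/
theorem measurableSpace_eq_generateFrom [Finite A] :
    Completion.instMeasurableSpace I = MeasurableSpace.generateFrom (toppingFibers I) := by
  apply le_antisymm
  · have hmeas : ∀ (n : ℕ) (S : Set (TraceMonoid I)),
        @MeasurableSet _ (MeasurableSpace.generateFrom (toppingFibers I))
          (topping n ⁻¹' S : Set (Completion I)) := fun n S => by
      rw [← Set.biUnion_of_singleton S, Set.preimage_iUnion₂]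
      exact @MeasurableSet.biUnion _ _ (MeasurableSpace.generateFrom (toppingFibers I)) _ _
        (Set.to_countable S)
        fun u _ => MeasurableSpace.measurableSet_generateFrom ⟨n, u, rfl⟩
    let B : Set (Set (Completion I)) :=
      Set.range (fun u : TraceMonoid I => {Completion.finite u}) ∪ Set.range fullCylinder
    have hB : Completion.instTopologicalSpace I = TopologicalSpace.generateFrom B := by
      apply le_antisymm
      · refine le_generateFrom ?_
        rintro s (⟨u, rfl⟩ | ⟨u, rfl⟩)
        · beta_reduce
          rw [← Set.image_singleton]
          exact isOpen_image_finite {u}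
        · exact isOpen_fullCylinder u
      · refine le_generateFrom ?_
        rintro s (⟨S, rfl⟩ | ⟨u, rfl⟩)
        · beta_reduce
          rw [← Set.biUnion_of_singleton S, Set.image_iUnion₂]
          refine @isOpen_biUnion _ _ (TopologicalSpace.generateFrom B) _ _ fun u _ => ?_
          rw [Set.image_singleton]
          exact .basic _ (Or.inl ⟨u, rfl⟩)
        · exact .basic _ (Or.inr ⟨u, rfl⟩)
    have hBc : B.Countable := (Set.countable_range _).union (Set.countable_range _)
    have hsc : SecondCountableTopology (Completion I) := ⟨B, hBc, hB⟩
    have : Completion.instMeasurableSpace I = MeasurableSpace.generateFrom B :=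
      borel_eq_generateFrom_of_subbasis hB
    rw [this]
    refine MeasurableSpace.generateFrom_le ?_
    rintro s (⟨u, rfl⟩ | ⟨u, rfl⟩)
    · obtain ⟨m, hm⟩ := exists_truncate_eq_self u
      beta_reduce
      rw [singleton_finite_eq_preimage hm]
      exact hmeas _ _
    · obtain ⟨m, hm⟩ := exists_truncate_eq_self u
      rw [fullCylinder_eq_preimage hm]
      exact hmeas _ _
  · refine MeasurableSpace.generateFrom_le ?_
    rintro s ⟨n, u, rfl⟩
    exact measurableSet_toppingFiber n u

/-- A coarser topping is a function of a finer one, so two fibres are nested or disjoint. -/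
theorem isPiSystem_toppingFibers : IsPiSystem (toppingFibers I) := by
  have key : ∀ (n m : ℕ) (u w : TraceMonoid I), n ≤ m →
      (topping n ⁻¹' {u} ∩ topping m ⁻¹' {w} : Set (Completion I)).Nonempty →
      (topping n ⁻¹' {u} ∩ topping m ⁻¹' {w} : Set (Completion I)) = topping m ⁻¹' {w} := by
    rintro n m u w hnm ⟨v, hv, hv'⟩
    refine Set.inter_eq_right.2 fun x hx => ?_
    simp only [Set.mem_preimage, Set.mem_singleton_iff] at *
    rw [← min_eq_left hnm, ← truncate_topping, hx, ← hv', truncate_topping, min_eq_left hnm, hv]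
  rintro _ ⟨n, u, rfl⟩ _ ⟨m, w, rfl⟩ hne
  rcases le_total n m with h | h
  · exact ⟨m, w, key n m u w h hne⟩
  · rw [Set.inter_comm] at hne ⊢
    exact ⟨n, u, key m n w u h hne⟩

open MeasureTheory in
theorem measure_ext_of_topping [Finite A] {μ ν : Measure (Completion I)} [IsProbabilityMeasure μ]
    [IsProbabilityMeasure ν]
    (h : ∀ (n : ℕ) (u : TraceMonoid I), μ (topping n ⁻¹' {u}) = ν (topping n ⁻¹' {u})) :
    μ = ν := by
  refine ext_of_generate_finite _ measurableSpace_eq_generateFrom isPiSystem_toppingFibers ?_ ?_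
  · rintro _ ⟨n, u, rfl⟩
    exact h n u
  · rw [measure_univ, measure_univ]

end Measurable

/-! ### Möbius inversion and the law of the toppings. -/

section Weight

open scoped Classical in
theorem truncate_mul_toTrace_iff {A : Type*} {I : SimpleGraph A} {m : ℕ} {u : TraceMonoid I}
    (hu : truncate (m + 1) u = u) (d : Clique I) :
    truncate (m + 1) (u * d.toTrace) = u * d.toTrace ↔
      ∀ a ∈ d.1, ∀ b ∈ levelSet u m, I.Adj b a := by
  have hempty : ∀ {v : TraceMonoid I}, truncate (m + 1) v = v →
      ∀ i, m < i → levelSet v i = ∅ := fun hv i hi =>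
    truncate_eq_self_iff.1 (truncate_eq_self_of_le hi hv)
  constructor
  · intro h a ha b hb
    by_contra hba
    have hlev : m + 1 ≤ dropLevel I a (levelSet u) := by
      by_contra! hlt
      exact hba (adj_of_dropLevel_le (Nat.lt_succ_iff.1 hlt) hb)
    have hcl : I.IsClique (({a} : Finset A) : Set A) := by simp
    obtain ⟨w, hw⟩ := toTrace_le (c := ⟨{a}, hcl⟩) (d := d) (Finset.singleton_subset_iff.2 ha)
    have hsing : Clique.toTrace ⟨{a}, hcl⟩ = letter I a := Finset.noncommProd_singleton _ _
    have hsub := levelSet_subset_mul (u * letter I a) w (dropLevel I a (levelSet u))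
    rw [mul_assoc, ← hsing, ← hw, hempty h _ hlev, hsing, levelSet_mul_letter] at hsub
    exact Finset.notMem_empty a (hsub (mem_drop.2 (Or.inr ⟨rfl, rfl⟩)))
  · intro h
    suffices h' : truncate (m + 1) (u * d.toTrace) = u * d.toTrace ∧
        ∀ b ∈ levelSet (u * d.toTrace) m, b ∈ levelSet u m ∨ b ∈ d.1 from h'.1
    induction d using Clique.induction with
    | h0 =>
      rw [toTrace_empty, mul_one]
      exact ⟨hu, fun b hb => Or.inl hb⟩
    | h c d a ha hadj hdc hd ih =>
      obtain ⟨ih1, ih2⟩ := ih fun b hb => h b ((hdc b).2 (Or.inr hb))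
      rw [hd, ← mul_assoc]
      constructor
      · rw [truncate_mul_letter, if_neg, ih1]
        intro hlev
        obtain ⟨j, hj⟩ : ∃ j, dropLevel I a (levelSet (u * c.toTrace)) = j + 1 :=
          ⟨_, (Nat.succ_pred_eq_of_pos (by omega)).symm⟩
        obtain ⟨b, hb, hba⟩ := exists_not_adj_of_dropLevel_eq_succ hj
        rcases (show m ≤ j by omega).eq_or_lt with rfl | hlt
        · rcases ih2 b hb with hb | hb
          · exact hba (h a ((hdc a).2 (Or.inl rfl)) b hb)
          · exact hba (hadj b hb)
        · rw [hempty ih1 j hlt] at hb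
          exact Finset.notMem_empty b hb
      · intro b hb
        rw [levelSet_mul_letter] at hb
        rw [hdc]
        rcases mem_drop.1 hb with hb | ⟨rfl, -⟩
        · rcases ih2 b hb with hb | hb
          · exact Or.inl hb
          · exact Or.inr (Or.inr hb)
        · exact Or.inr (Or.inl rfl)

theorem truncate_eq_self_of_trace_le {A : Type*} {I : SimpleGraph A} {n : ℕ} {u v : TraceMonoid I}
    (h : u ≤ v) (hv : truncate n v = v) : truncate n u = u := by
  obtain ⟨w, rfl⟩ := h
  rw [truncate_eq_self_iff] at hv ⊢
  exact Finset.subset_empty.1 (hv ▸ levelSet_subset_mul u w n)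

variable {A : Type*} [Finite A] (I : SimpleGraph A)

/-- The finite set of all cliques. -/
def cliques : Finset (Clique I) := (Set.finite_univ (α := Clique I)).toFinset

variable {I} in
theorem mem_cliques (c : Clique I) : c ∈ cliques I := by simp [cliques]

theorem finite_truncate_eq_self (n : ℕ) : {u : TraceMonoid I | truncate n u = u}.Finite := by
  induction n with
  | zero =>
    refine (Set.finite_singleton (1 : TraceMonoid I)).subset fun u hu => ?_
    exact (show truncate 0 u = u from hu).symm
  | succ n ih =>
    refine (Set.Finite.image2 (fun u (c : Clique I) => u * c.toTrace) ih
      (Set.finite_univ (α := Clique I))).subset fun u hu => ?_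
    refine ⟨truncate n u, ?_, levels u n, Set.mem_univ _, ?_⟩
    · rw [Set.mem_ofPred_eq, truncate_truncate, min_self]
    · exact (prefixProd_succ _ n).symm.trans hu

/-- The finite set of traces of height at most `n`. -/
def truncated (n : ℕ) : Finset (TraceMonoid I) := (finite_truncate_eq_self I n).toFinset

variable {I}

theorem mem_truncated {n : ℕ} {u : TraceMonoid I} : u ∈ truncated I n ↔ truncate n u = u := by
  simp [truncated]

open scoped Classical in
theorem sum_cliques_subset (S : Finset A) (f : Finset A → ℝ) :
    ∑ d ∈ cliques I, (if d.1 ⊆ S then f d.1 else 0) =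
      ∑ c ∈ S.powerset, if I.IsClique (c : Set A) then f c else 0 := by
  rw [← Finset.sum_filter, ← Finset.sum_filter]
  refine Finset.sum_bij (fun d _ => d.1) ?_ (fun _ _ _ _ h => Subtype.ext h) ?_ fun _ _ => rfl
  · intro d hd
    exact Finset.mem_filter.2 ⟨Finset.mem_powerset.2 (Finset.mem_filter.1 hd).2, d.2⟩
  · intro c hc
    obtain ⟨h1, h2⟩ := Finset.mem_filter.1 hc
    exact ⟨⟨c, h2⟩, Finset.mem_filter.2 ⟨mem_cliques _, Finset.mem_powerset.1 h1⟩, rfl⟩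

-- After reversal, the cliques dividing `y` on the right are the subsets of one bottom level `D`,
-- itself a clique. Their alternating sum vanishes unless `D` is empty.
open scoped Classical in
theorem sum_clique_right_divisors (y : TraceMonoid I) :
    ∑ d ∈ cliques I, (if ∃ u, u * d.toTrace = y then (-1 : ℝ) ^ d.1.card else 0) =
      if y = 1 then 1 else 0 := by
  set D := levelSet (rev y).unop 0 with hD
  have hdvd : ∀ d : Clique I, (∃ u, u * d.toTrace = y) ↔ d.1 ⊆ D := fun d => by
    rw [hD, ← toTrace_le_iff]
    constructor
    · rintro ⟨u, rfl⟩
      refine ⟨(rev u).unop, ?_⟩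
      rw [map_mul, MulOpposite.unop_mul, rev_toTrace]
    · rintro ⟨w, hw⟩
      refine ⟨(rev w).unop, ?_⟩
      rw [← rev_rev y, hw, map_mul, MulOpposite.unop_mul, rev_toTrace]
  have hone : D = ∅ ↔ y = 1 := by
    rw [hD, ← truncate_eq_self_iff]
    constructor
    · intro h
      have h1 : (rev y).unop = 1 := h.symm
      rw [← rev_rev y, h1, map_one, MulOpposite.unop_one]
    · rintro rfl
      rw [map_one, MulOpposite.unop_one]
      rfl
  simp_rw [hdvd]
  rw [sum_cliques_subset D fun c => (-1 : ℝ) ^ c.card]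
  have hcl : ∀ c ∈ D.powerset, (if I.IsClique (c : Set A) then (-1 : ℝ) ^ c.card else 0) =
      (((-1 : ℤ) ^ c.card : ℤ) : ℝ) := fun c hc => by
    rw [if_pos ((isClique_levelSet _ 0).subset (Finset.coe_subset.2 (Finset.mem_powerset.1 hc)))]
    push_cast
    rfl
  rw [Finset.sum_congr rfl hcl, ← Int.cast_sum, Finset.sum_powerset_neg_one_pow_card]
  simp [hone]

variable (I) in
open scoped Classical in
/-- The probability that the `n`-topping is `u`: the Möbius transform of `u ↦ p ^ |u|` on the
traces of height at most `n`. -/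
def toppingWeight (n : ℕ) (p : ℝ) (u : TraceMonoid I) : ℝ :=
  ∑ d ∈ cliques I, if truncate n (u * d.toTrace) = u * d.toTrace then
    (-1) ^ d.1.card * p ^ length (u * d.toTrace) else 0

-- Collect the double sum by `y = u d`. Only `y = x w` contributes, and cancelling `x` turns its
-- coefficient into the alternating sum over clique right divisors of `w`, which isolates `w = 1`.
open scoped Classical in
theorem sum_toppingWeight {n : ℕ} (p : ℝ) {x : TraceMonoid I} (hx : truncate n x = x) :
    ∑ u ∈ truncated I n with x ≤ u, toppingWeight I n p u = p ^ length x := by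
  have h1 : ∀ u (d : Clique I), (if truncate n (u * d.toTrace) = u * d.toTrace then
      (-1 : ℝ) ^ d.1.card * p ^ length (u * d.toTrace) else 0) =
      ∑ y ∈ truncated I n, if u * d.toTrace = y then (-1 : ℝ) ^ d.1.card * p ^ length y else 0 := by
    intro u d
    rw [Finset.sum_ite_eq]
    simp only [mem_truncated]
  unfold toppingWeight
  simp_rw [h1]
  refine ((Finset.sum_comm.trans (Finset.sum_congr rfl fun d _ => Finset.sum_comm)).trans
    Finset.sum_comm).trans ?_
  have h2 : ∀ y ∈ truncated I n, ∑ d ∈ cliques I, ∑ u ∈ truncated I n with x ≤ u,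
      (if u * d.toTrace = y then (-1 : ℝ) ^ d.1.card * p ^ length y else 0) =
      if y = x then p ^ length y else 0 := by
    intro y hy
    by_cases hxy : x ≤ y
    · obtain ⟨w, rfl⟩ := hxy
      have h3 : ∀ d ∈ cliques I, ∑ u ∈ truncated I n with x ≤ u,
          (if u * d.toTrace = x * w then (-1 : ℝ) ^ d.1.card * p ^ length (x * w) else 0) =
          (if ∃ v, v * d.toTrace = w then (-1 : ℝ) ^ d.1.card else 0) * p ^ length (x * w) := by
        intro d _
        by_cases hd : ∃ v, v * d.toTrace = w
        · obtain ⟨v, rfl⟩ := hd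
          rw [if_pos ⟨v, rfl⟩, Finset.sum_eq_single (x * v), if_pos (mul_assoc _ _ _)]
          · intro u _ hu
            refine if_neg fun h => hu ?_
            rw [← mul_assoc] at h
            exact trace_mul_right_cancel h
          · intro h
            refine absurd (Finset.mem_filter.2 ⟨mem_truncated.2 ?_, ⟨v, rfl⟩⟩) h
            exact truncate_eq_self_of_trace_le ⟨d.toTrace, (mul_assoc _ _ _).symm⟩
              (mem_truncated.1 hy)
        · rw [if_neg hd, zero_mul]
          refine Finset.sum_eq_zero fun u hu => if_neg fun h => hd ?_
          obtain ⟨v, rfl⟩ := (Finset.mem_filter.1 hu).2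
          rw [mul_assoc] at h
          exact ⟨v, trace_mul_left_cancel h⟩
      rw [Finset.sum_congr rfl h3, ← Finset.sum_mul, sum_clique_right_divisors]
      by_cases hw : w = 1
      · simp [hw]
      · rw [if_neg hw, if_neg, zero_mul]
        intro h
        exact hw (trace_mul_left_cancel (h.trans (mul_one x).symm))
    · rw [if_neg fun h : y = x => hxy (h ▸ trace_le_refl y)]
      refine Finset.sum_eq_zero fun d _ => Finset.sum_eq_zero fun u hu => if_neg ?_
      rintro rfl
      exact hxy (trace_le_trans (Finset.mem_filter.1 hu).2 ⟨_, rfl⟩)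
  rw [Finset.sum_congr rfl h2, Finset.sum_ite_eq', if_pos (mem_truncated.2 hx)]

-- Appending `d` keeps the height at most `m + 1` exactly when level `m` blocks no letter of `d`. If
-- level `m` is empty, `S` is the whole alphabet.
open scoped Classical in
theorem toppingWeight_succ (p : ℝ) {m : ℕ} {u : TraceMonoid I} (hu : truncate (m + 1) u = u) :
    ∃ S : Finset A, (∀ a, a ∈ S ↔ ∀ b ∈ levelSet u m, I.Adj b a) ∧
      toppingWeight I (m + 1) p u = p ^ length u * cliqueSum I S p := by
  refine ⟨(Set.toFinite {a | ∀ b ∈ levelSet u m, I.Adj b a}).toFinset, fun a => by simp, ?_⟩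
  unfold cliqueSum
  rw [← sum_cliques_subset _ fun c => (-p) ^ c.card, Finset.mul_sum, toppingWeight]
  refine Finset.sum_congr rfl fun d _ => ?_
  rw [mul_ite, mul_zero]
  refine if_congr ?_ ?_ rfl
  · rw [truncate_mul_toTrace_iff hu, Finset.subset_iff]
    simp
  · rw [length_mul, length_toTrace, neg_pow, pow_add]
    ring

-- The system of sums over upper sets is triangular for divisibility, so it is solved from the
-- longest traces downwards.
open scoped Classical in
theorem eq_of_sum_filter_le_eq {n : ℕ} {f g : TraceMonoid I → ℝ}
    (h : ∀ x, truncate n x = x → ∑ u ∈ truncated I n with x ≤ u, f u =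
      ∑ u ∈ truncated I n with x ≤ u, g u) {x : TraceMonoid I} (hx : truncate n x = x) :
    f x = g x := by
  induction hk : (truncated I n).sup length - length x using Nat.strong_induction_on
    generalizing x with
  | _ k ih =>
  have hmem : x ∈ (truncated I n).filter fun u => x ≤ u :=
    Finset.mem_filter.2 ⟨mem_truncated.2 hx, trace_le_refl x⟩
  have h1 := h x hx
  rw [← Finset.add_sum_erase _ _ hmem, ← Finset.add_sum_erase _ _ hmem,
    Finset.sum_congr rfl fun u hu => ?_] at h1
  · exact add_right_cancel h1
  · obtain ⟨hne, hu⟩ := Finset.mem_erase.1 hu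
    obtain ⟨hu, hxu⟩ := Finset.mem_filter.1 hu
    have hlt : length x < length u := by
      by_contra! hle
      exact hne (eq_of_le_of_length_le hxu hle).symm
    have hle : length u ≤ (truncated I n).sup length := Finset.le_sup hu
    exact ih _ (by omega) (mem_truncated.1 hu) rfl

-- Both sides have sum `p^|x|` over the traces above each `x` of height at most `n`, so inversion
-- identifies them.
open scoped Classical in
theorem sum_toppingWeight_succ (p : ℝ) {n : ℕ} {u : TraceMonoid I} (hu : truncate n u = u) :
    ∑ w ∈ truncated I (n + 1) with truncate n w = u, toppingWeight I (n + 1) p w =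
      toppingWeight I n p u := by
  refine eq_of_sum_filter_le_eq (n := n) (f := fun u =>
    ∑ w ∈ truncated I (n + 1) with truncate n w = u, toppingWeight I (n + 1) p w)
    (fun x hx => ?_) hu
  rw [sum_toppingWeight p hx, ← sum_toppingWeight p (truncate_eq_self_of_le (Nat.le_succ n) hx)]
  refine Eq.trans (Finset.sum_congr rfl fun u hu => Finset.sum_congr ?_ fun _ _ => rfl)
    (Finset.sum_fiberwise_of_maps_to (g := truncate n) (t := (truncated I n).filter fun u => x ≤ u)
      (fun w hw => ?_) _)
  · rw [Finset.filter_filter]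
    refine Finset.filter_congr fun w _ => ⟨fun h => ⟨?_, h⟩, fun h => h.2⟩
    exact trace_le_trans (h ▸ (Finset.mem_filter.1 hu).2) (truncate_le n w)
  · obtain ⟨-, hxw⟩ := Finset.mem_filter.1 hw
    refine Finset.mem_filter.2 ⟨mem_truncated.2 ?_, hx ▸ truncate_mono n hxw⟩
    rw [truncate_truncate, min_self]

theorem toppingWeight_nonneg {p : ℝ} (hp0 : 0 ≤ p) (hp : ∀ S : Finset A, 0 ≤ cliqueSum I S p)
    {n : ℕ} {u : TraceMonoid I} (hu : truncate n u = u) : 0 ≤ toppingWeight I n p u := by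
  classical
  rcases n with _ | m
  -- At height 0 there is no last level to read the weight from; projectivity expresses it through
  -- height 1.
  · rw [← sum_toppingWeight_succ p hu]
    refine Finset.sum_nonneg fun w hw => ?_
    obtain ⟨S, -, hS⟩ := toppingWeight_succ p (mem_truncated.1 (Finset.mem_filter.1 hw).1)
    rw [hS]
    exact mul_nonneg (pow_nonneg hp0 _) (hp S)
  · obtain ⟨S, -, hS⟩ := toppingWeight_succ p hu
    rw [hS]
    exact mul_nonneg (pow_nonneg hp0 _) (hp S)

end Weight

/-! ### Construction and uniqueness of the measures. -/

section Measures

open MeasureTheory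

variable {A : Type*} {I : SimpleGraph A}

theorem fullCylinder_one : fullCylinder (1 : TraceMonoid I) = Set.univ :=
  Set.eq_univ_of_forall fun v =>
    (finite_le_iff (m := 0) rfl v).2 ⟨_, (one_mul (topping 0 v)).symm⟩

theorem measurableSet_fullCylinder (u : TraceMonoid I) : MeasurableSet (fullCylinder u) :=
  (isOpen_fullCylinder u).measurableSet

theorem toppingFiber_eq_empty {n : ℕ} {u : TraceMonoid I} (hu : truncate n u ≠ u) :
    (topping n ⁻¹' {u} : Set (Completion I)) = ∅ := by
  refine Set.eq_empty_of_forall_notMem fun v hv => hu ?_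
  rw [← Set.mem_singleton_iff.1 (Set.mem_preimage.1 hv), truncate_topping, min_self]

open scoped Classical in
theorem measureReal_fullCylinder [Finite A] (μ : Measure (Completion I)) [IsFiniteMeasure μ] {n : ℕ}
    {x : TraceMonoid I} (hx : truncate n x = x) :
    μ.real (fullCylinder x) =
      ∑ u ∈ truncated I n with x ≤ u, μ.real (topping n ⁻¹' {u}) := by
  rw [← measureReal_biUnion_finset]
  · congr 1
    ext v
    rw [fullCylinder_eq_preimage hx]
    simp only [Set.mem_preimage, Set.mem_iUnion, Set.mem_singleton_iff, exists_prop,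
      Finset.mem_filter, Set.mem_ofPred_eq, mem_truncated]
    constructor
    · intro h
      exact ⟨topping n v, ⟨by rw [truncate_topping, min_self], h⟩, rfl⟩
    · rintro ⟨u, ⟨-, h⟩, rfl⟩
      exact h
  · intro u _ w _ huw
    refine Set.disjoint_left.2 fun v hv hv' => huw ?_
    exact (Set.mem_singleton_iff.1 hv).symm.trans (Set.mem_singleton_iff.1 hv')
  · exact fun u _ => measurableSet_toppingFiber n u

/-- A probability measure on the completion is determined by its values on full cylinders. -/
theorem measure_ext_of_fullCylinder [Finite A] {μ ν : Measure (Completion I)}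
    [IsProbabilityMeasure μ]
    [IsProbabilityMeasure ν] (h : ∀ x : TraceMonoid I, μ (fullCylinder x) = ν (fullCylinder x)) :
    μ = ν := by
  classical
  refine measure_ext_of_topping fun n u => ?_
  by_cases hu : truncate n u = u
  · have := eq_of_sum_filter_le_eq (n := n) (f := fun u => μ.real (topping n ⁻¹' {u}))
      (g := fun u => ν.real (topping n ⁻¹' {u})) (fun x hx => by
        rw [← measureReal_fullCylinder μ hx, ← measureReal_fullCylinder ν hx,
          measureReal_def, measureReal_def, h]) hu
    exact (measureReal_eq_measureReal_iff).1 this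
  · rw [toppingFiber_eq_empty hu, measure_empty, measure_empty]

/-- A projective system of weights on toppings defines a measure on the completion. -/
theorem exists_measure_of_weights [Finite A] {w : ℕ → TraceMonoid I → ℝ}
    (hw0 : ∀ n u, truncate n u = u → 0 ≤ w n u) (hw1 : ∀ n, ∑ u ∈ truncated I n, w n u = 1)
    (hw : ∀ n u, truncate n u = u →
      (by classical exact ∑ x ∈ truncated I (n + 1) with truncate n x = u, w (n + 1) x) = w n u) :
    ∃ ν : Measure (Completion I), IsProbabilityMeasure ν ∧
      ∀ n u, truncate n u = u → ν.real (topping n ⁻¹' {u}) = w n u := by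
  classical
  let _ : MeasurableSpace (TraceMonoid I) := ⊤
  have : DiscreteMeasurableSpace (TraceMonoid I) := ⟨fun _ => trivial⟩
  let P : ℕ → Measure (TraceMonoid I) := fun n =>
    ∑ u ∈ truncated I n, ENNReal.ofReal (w n u) • Measure.dirac u
  have hP : ∀ n s, P n s = ∑ u ∈ truncated I n with u ∈ s, ENNReal.ofReal (w n u) := fun n s => by
    simp only [P, Measure.finsetSum_apply, Measure.smul_apply, smul_eq_mul,
      Measure.dirac_apply' _ (MeasurableSet.of_discrete (s := s)), Finset.sum_filter]
    exact Finset.sum_congr rfl fun u _ => by by_cases hu : u ∈ s <;> simp [hu]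
  have hPr : ∀ n s, P n s = ENNReal.ofReal (∑ u ∈ truncated I n with u ∈ s, w n u) :=
    fun n s => by
      rw [hP, ENNReal.ofReal_sum_of_nonneg]
      exact fun u hu => hw0 n u (mem_truncated.1 (Finset.mem_filter.1 hu).1)
  have hprob : ∀ n, IsProbabilityMeasure (P n) := fun n => ⟨by
    rw [hPr]
    simp [hw1 n]⟩
  have hsing : ∀ n u, truncate n u = u → P n {u} = ENNReal.ofReal (w n u) := fun n u hu => by
    rw [hPr]
    congr 1
    rw [Finset.sum_eq_single_of_mem u (by simp [mem_truncated, hu])]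
    intro b hb hbu
    exact absurd (Finset.mem_filter.1 hb).2 hbu
  obtain ⟨μ, hμ, hmarg, hae⟩ := exists_measure_of_map_succ_eq P truncate fun n => by
    refine Measure.ext_of_singleton fun u => ?_
    rw [Measure.map_apply Measurable.of_discrete MeasurableSet.of_discrete]
    by_cases hu : truncate n u = u
    · rw [hsing n u hu, hPr, ← hw n u hu]
      rfl
    · rw [hP, hP, Finset.filter_false_of_mem, Finset.filter_false_of_mem, Finset.sum_empty,
        Finset.sum_empty]
      · rintro x hx rfl
        exact hu (mem_truncated.1 hx)
      · rintro x - hx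
        refine hu ?_
        rw [← Set.mem_singleton_iff.1 (Set.mem_preimage.1 hx), truncate_truncate, min_self]
  -- The value on incompatible sequences is arbitrary, since they form a null set.
  let Ψ : (ℕ → TraceMonoid I) → Completion I := fun ω =>
    if h : ∀ n, truncate n (ω (n + 1)) = ω n then (exists_topping_eq h).choose else .finite 1
  have hΨ : ∀ ω, (∀ n, truncate n (ω (n + 1)) = ω n) → ∀ n, topping n (Ψ ω) = ω n :=
    fun ω h n => by
      simp only [Ψ, dif_pos h]
      exact (exists_topping_eq h).choose_spec n
  have hmeas : Measurable Ψ := by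
    have hG : MeasurableSet {ω : ℕ → TraceMonoid I | ∀ n, truncate n (ω (n + 1)) = ω n} := by
      rw [Set.ofPred_forall]
      refine MeasurableSet.iInter fun n => ?_
      exact measurableSet_eq_fun
        ((Measurable.of_discrete (f := truncate n)).comp (measurable_pi_apply (n + 1)))
        (measurable_pi_apply n)
    have : @Measurable _ _ _ (MeasurableSpace.generateFrom (toppingFibers I)) Ψ := by
      refine measurable_generateFrom ?_
      rintro _ ⟨n, u, rfl⟩
      have heq : Ψ ⁻¹' (topping n ⁻¹' {u}) =
          {ω : ℕ → TraceMonoid I | ∀ n, truncate n (ω (n + 1)) = ω n}.ite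
            ((fun ω => ω n) ⁻¹' {u}) {_ω | topping n (.finite (1 : TraceMonoid I)) = u} := by
        ext ω
        by_cases h : ∀ n, truncate n (ω (n + 1)) = ω n
        · simp [Set.ite, h, hΨ ω h]
        · simp only [Set.ite, Set.mem_preimage, Set.mem_singleton_iff, Set.mem_union,
            Set.mem_inter_iff, Set.mem_sdiff, Set.mem_ofPred_eq, h, and_false, false_or,
            not_false_eq_true, and_true]
          simp only [Ψ, dif_neg h]
      rw [heq]
      exact hG.ite (measurable_pi_apply n MeasurableSet.of_discrete) (.const _)
    rwa [← measurableSpace_eq_generateFrom] at this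
  refine ⟨μ.map Ψ, Measure.isProbabilityMeasure_map hmeas.aemeasurable, fun n u hu => ?_⟩
  rw [measureReal_def, Measure.map_apply hmeas (measurableSet_toppingFiber n u),
    measure_congr (t := (fun ω => ω n) ⁻¹' {u}), ← Measure.map_apply (measurable_pi_apply n)
      MeasurableSet.of_discrete, hmarg, hsing n u hu, ENNReal.toReal_ofReal (hw0 n u hu)]
  filter_upwards [hae] with ω hω
  refine propext ?_
  change topping n (Ψ ω) = u ↔ ω n = u
  rw [hΨ ω hω]

theorem exists_measure_fullCylinder [Finite A] {p : ℝ} (hp0 : 0 < p)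
    (hp : ∀ S : Finset A, 0 ≤ cliqueSum I S p) :
    ∃ ν : Measure (Completion I), IsProbabilityMeasure ν ∧
      (∀ x : TraceMonoid I, ν (fullCylinder x) = ENNReal.ofReal (p ^ x.length)) ∧
      ∀ (S : Finset A), (∀ a, a ∈ S) → ∀ x : TraceMonoid I,
        ν {Completion.finite x} = ENNReal.ofReal (p ^ x.length * cliqueSum I S p) := by
  classical
  obtain ⟨ν, hν, hfib⟩ := exists_measure_of_weights (I := I) (w := fun n u => toppingWeight I n p u)
    (fun n u hu => toppingWeight_nonneg hp0.le hp hu)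
    (fun n => by
      have h := sum_toppingWeight (n := n) p (x := (1 : TraceMonoid I))
        (truncate_eq_self fun i _ => levelSet_one i)
      rw [length_one, pow_zero, Finset.filter_true_of_mem] at h
      · exact h
      · exact fun u _ => ⟨u, (one_mul u).symm⟩)
    (fun n u hu => sum_toppingWeight_succ p hu)
  refine ⟨ν, hν, fun x => ?_, fun S hS x => ?_⟩
  · obtain ⟨n, hn⟩ := exists_truncate_eq_self x
    rw [← ofReal_measureReal, measureReal_fullCylinder ν hn, ← sum_toppingWeight p hn]
    congr 1
    exact Finset.sum_congr rfl fun u hu => hfib n u (mem_truncated.1 (Finset.mem_filter.1 hu).1)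
  · obtain ⟨m, hm⟩ := exists_truncate_eq_self x
    have hm' := truncate_eq_self_of_le (Nat.le_succ m) hm
    obtain ⟨T, hT, hw⟩ := toppingWeight_succ p hm'
    have hTS : T = S := by
      ext a
      rw [hT, truncate_eq_self_iff.1 hm]
      simp [hS]
    rw [← ofReal_measureReal, singleton_finite_eq_preimage hm, hfib _ _ hm', hw, hTS]

theorem hasSum_pow_length_mul {p : ℝ} (hs : Summable fun u : TraceMonoid I => p ^ u.length)
    (x : TraceMonoid I) : HasSum (fun w : TraceMonoid I => p ^ (x * w).length)
      (p ^ x.length * growthSeries I p) := by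
  simp_rw [length_mul, pow_add]
  exact hs.hasSum.mul_left _

theorem growthSeries_pos {p : ℝ} (hp0 : 0 < p)
    (hs : Summable fun u : TraceMonoid I => p ^ u.length) : 0 < growthSeries I p :=
  hs.tsum_pos (fun _ => (pow_pos hp0 _).le) 1 (pow_pos hp0 _)

/-- The probability measure on finite traces with weights proportional to `p ^ |u|`. -/
def boltzmann (I : SimpleGraph A) (p : ℝ) : Measure (Completion I) :=
  Measure.sum fun u : TraceMonoid I =>
    ENNReal.ofReal (p ^ u.length / growthSeries I p) • Measure.dirac (Completion.finite u)

theorem boltzmann_apply (p : ℝ) {s : Set (Completion I)} (hs : MeasurableSet s) :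
    boltzmann I p s = ∑' u : TraceMonoid I, (Completion.finite ⁻¹' s).indicator
      (fun u => ENNReal.ofReal (p ^ u.length / growthSeries I p)) u := by
  rw [boltzmann, Measure.sum_apply _ hs]
  refine tsum_congr fun u => ?_
  rw [Measure.smul_apply, smul_eq_mul, Measure.dirac_apply' _ hs]
  by_cases hu : Completion.finite u ∈ s
  · rw [Set.indicator_of_mem hu, Set.indicator_of_mem (by exact hu)]
    simp
  · rw [Set.indicator_of_notMem hu, Set.indicator_of_notMem (by exact hu), mul_zero]

/-- By left cancellation `w ↦ x w` is a bijection onto the finite traces above `x`, so their total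
weight is `p^|x| G(p) / G(p)`. -/
theorem boltzmann_fullCylinder {p : ℝ} (hp0 : 0 < p)
    (hs : Summable fun u : TraceMonoid I => p ^ u.length) (x : TraceMonoid I) :
    boltzmann I p (fullCylinder x) = ENNReal.ofReal (p ^ x.length) := by
  have hG := growthSeries_pos hp0 hs
  have hinj : Function.Injective fun w : TraceMonoid I => x * w := fun _ _ =>
    trace_mul_left_cancel
  rw [boltzmann_apply p (measurableSet_fullCylinder x), ← hinj.tsum_eq]
  · have h : ∀ w : TraceMonoid I, (Completion.finite ⁻¹' fullCylinder x).indicator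
        (fun u => ENNReal.ofReal (p ^ u.length / growthSeries I p)) (x * w) =
        ENNReal.ofReal (p ^ (x * w).length / growthSeries I p) := fun w =>
      Set.indicator_of_mem (show _ ∈ _ from finite_le_finite_iff.2 ⟨w, rfl⟩) _
    have hsum := (hasSum_pow_length_mul hs x).div_const (growthSeries I p)
    simp_rw [h]
    rw [← ENNReal.ofReal_tsum_of_nonneg (fun w => by positivity) hsum.summable, hsum.tsum_eq,
      mul_div_cancel_right₀ _ hG.ne']
  · intro u hu
    obtain ⟨w, rfl⟩ := finite_le_finite_iff.1 (Set.mem_of_indicator_ne_zero hu)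
    exact ⟨w, rfl⟩

theorem finite_injective :
    Function.Injective (Completion.finite : TraceMonoid I → Completion I) :=
  fun _ _ h => Completion.finite.inj h

theorem boltzmann_singleton (p : ℝ) (x : TraceMonoid I) :
    boltzmann I p {Completion.finite x} = ENNReal.ofReal (p ^ x.length / growthSeries I p) := by
  rw [boltzmann_apply p (measurableSet_singleton_finite x), tsum_eq_single x]
  · exact Set.indicator_of_mem (by simp) _
  · intro u hu
    have hmem : u ∉ Completion.finite ⁻¹' {Completion.finite x} := fun h =>
      hu (finite_injective h)
    exact Set.indicator_of_notMem hmem _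

theorem measurableSet_finiteTraces : MeasurableSet (finiteTraces I) := by
  rw [finiteTraces, ← Set.image_univ]
  exact (isOpen_image_finite Set.univ).measurableSet

theorem boltzmann_finiteTraces (p : ℝ) :
    boltzmann I p (finiteTraces I) = boltzmann I p Set.univ := by
  rw [boltzmann_apply p measurableSet_finiteTraces, boltzmann_apply p .univ, finiteTraces,
    Set.preimage_range, Set.preimage_univ]

/-- Disjoint atoms have total mass at most 1, which bounds every partial sum of the growth series by
`c⁻¹`. -/
theorem summable_of_measure_singleton {p c : ℝ} (hp0 : 0 < p) (hc : 0 < c)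
    (ν : Measure (Completion I)) [IsProbabilityMeasure ν]
    (h : ∀ x : TraceMonoid I, ν {Completion.finite x} = ENNReal.ofReal (p ^ x.length * c)) :
    Summable fun u : TraceMonoid I => p ^ u.length := by
  refine summable_of_sum_le (c := c⁻¹) (fun u => (pow_pos hp0 _).le) fun F => ?_
  rw [← one_div, le_div_iff₀ hc, Finset.sum_mul]
  calc ∑ u ∈ F, p ^ u.length * c = ∑ u ∈ F, ν.real {Completion.finite u} :=
        Finset.sum_congr rfl fun u _ => by
          rw [measureReal_def, h, ENNReal.toReal_ofReal (by positivity)]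
    _ = ν.real (⋃ u ∈ F, {Completion.finite u}) := by
        rw [measureReal_biUnion_finset]
        · intro u _ w _ huw
          exact Set.disjoint_singleton.2 fun h => huw (finite_injective h)
        · exact fun u _ => measurableSet_singleton_finite u
    _ ≤ 1 := measureReal_le_one

theorem compl_finiteTraces : (finiteTraces I)ᶜ = infiniteTraces I := by
  ext v
  cases v <;> simp [finiteTraces, infiniteTraces]

theorem aeval_mobiusPolynomial [Finite A] {S : Finset A} (hS : ∀ a, a ∈ S) (z : ℂ) :
    Polynomial.aeval z (mobiusPolynomial I) = cliqueSum I S z := by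
  classical
  rw [mobiusPolynomial, cliqueSum, map_sum, ← Finset.sum_filter]
  refine Finset.sum_congr ?_ fun c _ => ?_
  · ext c
    simp [Finset.subset_iff, hS]
  · rw [neg_pow z]
    simp

end Measures

end

end TraceMonoid

/-! ### The subcritical and critical cases. -/

open TraceMonoid MeasureTheory in
theorem theorem3 {A : Type*} [Finite A] [Nonempty A] (I : SimpleGraph A) :
    ∃ p₀ : ℝ, 0 < p₀ ∧ TraceMonoid.IsPrincipalRoot I (p₀ : ℂ) ∧
      ∀ p : ℝ, 0 < p → p ≤ p₀ →
        ∃ ν : MeasureTheory.Measure (TraceMonoid.Completion I),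
          MeasureTheory.IsProbabilityMeasure ν ∧
          (∀ x : TraceMonoid I,
            ν (TraceMonoid.fullCylinder x) = ENNReal.ofReal (p ^ x.length)) ∧
          (∀ ν' : MeasureTheory.Measure (TraceMonoid.Completion I),
            MeasureTheory.IsProbabilityMeasure ν' →
            (∀ x : TraceMonoid I,
              ν' (TraceMonoid.fullCylinder x) = ENNReal.ofReal (p ^ x.length)) →
            ν' = ν) ∧
          (p < p₀ →
            ν (TraceMonoid.finiteTraces I) = 1 ∧
            Summable (fun u : TraceMonoid I => p ^ u.length) ∧
            ∀ x : TraceMonoid I, ν {TraceMonoid.Completion.finite x} =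
              ENNReal.ofReal (p ^ x.length / TraceMonoid.growthSeries I p)) ∧
          (p = p₀ →
            ν (TraceMonoid.infiniteTraces I) = 1 ∧
            ∀ x : TraceMonoid I,
              ν (TraceMonoid.cylinder x) = ENNReal.ofReal (p₀ ^ x.length)) := by
  classical
  obtain ⟨S, hS⟩ : ∃ S : Finset A, ∀ a, a ∈ S :=
    ⟨(Set.finite_univ (α := A)).toFinset, fun a => by simp⟩
  obtain ⟨p₀, hp₀, hroot, hpos, hmin⟩ :=
    exists_least_root_cliqueSum I (S := S) ⟨Classical.arbitrary A, hS _⟩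
  -- Strict positivity holds only to the left of `p₀`; a left limit gives the non-negativity needed
  -- at `p₀` itself.
  have hnonneg : ∀ p : ℝ, 0 < p → p ≤ p₀ → ∀ T : Finset A, 0 ≤ cliqueSum I T p := by
    intro p hp hpp T
    refine ge_of_tendsto (x := nhdsWithin p (Set.Iio p))
      ((continuous_cliqueSum I T).continuousAt.tendsto.mono_left nhdsWithin_le_nhds) ?_
    filter_upwards [Ioo_mem_nhdsLT hp] with t ht
    exact (cliqueSum_pos_of_subset I (fun a _ => hS a) hpos t ht.1.le (ht.2.trans_le hpp)).le
  refine ⟨p₀, hp₀, ⟨?_, fun w hw hne => ?_⟩, fun p hp hpp => ?_⟩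
  · rw [aeval_mobiusPolynomial hS, ← ofReal_cliqueSum, hroot, Complex.ofReal_zero]
  · rw [aeval_mobiusPolynomial hS] at hw
    rw [Complex.norm_real, Real.norm_of_nonneg hp₀.le]
    exact hmin w hw hne
  obtain ⟨ν, hν, hcyl, hsing⟩ := exists_measure_fullCylinder (I := I) hp (hnonneg p hp hpp)
  refine ⟨ν, hν, hcyl, fun ν' hν' h => ?_, fun hlt => ?_, ?_⟩
  · exact measure_ext_of_fullCylinder fun x => by rw [h, hcyl]
  -- Here the constant is `μ_A(p) > 0`. Cylinder values then identify `ν` with the normalised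
  -- measure, from which the atoms are read off.
  · have hsum := summable_of_measure_singleton hp (hpos p hp.le hlt) ν (hsing S hS)
    have hprob : IsProbabilityMeasure (boltzmann I p) := ⟨by
      rw [← fullCylinder_one, boltzmann_fullCylinder hp hsum, length_one, pow_zero,
        ENNReal.ofReal_one]⟩
    have heq : boltzmann I p = ν := measure_ext_of_fullCylinder fun x => by
      rw [boltzmann_fullCylinder hp hsum, hcyl]
    refine ⟨?_, hsum, fun x => ?_⟩
    · rw [← heq, boltzmann_finiteTraces, measure_univ]
    · rw [← heq, boltzmann_singleton]
  · rintro rfl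
    have hnull : ν (finiteTraces I) = 0 := by
      rw [finiteTraces, ← Set.iUnion_singleton_eq_range, measure_iUnion_null_iff]
      intro x
      rw [hsing S hS, hroot, mul_zero, ENNReal.ofReal_zero]
    refine ⟨?_, fun x => ?_⟩
    · rw [← compl_finiteTraces, prob_compl_eq_one_sub measurableSet_finiteTraces, hnull, tsub_zero]
    · rw [← hcyl]
      have : cylinder x = fullCylinder x \ finiteTraces I := by
        ext v
        rw [Set.sdiff_eq, compl_finiteTraces, Set.inter_comm]
        rfl
      rw [this, measure_sdiff_null hnull]
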